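/- Let $q$ be a power of a prime $p$, $A=\mathbb{F}_q[T]$, $\pi=1/T$, $K_\infty=\mathbb{F}_q((\pi))$, $\mathcal{O}_\infty=\mathbb{F}_q[[\pi]]$. "Ideal" means non-zero ideal of $A$, and $\deg$ of an ideal is the degree of its monic generator. Fix an ideal $\mathfrak{n}$, and let $\Gamma_0(\mathfrak{n})\subset \mathrm{GL}_2(A)$ be the subgroup of matrices whose lower left entry lies in $\mathfrak{n}$. Let $\mathcal{T}$ be the Bruhat–Tits tree of $\mathrm{PGL}_2(K_\infty)$, with vertices $\mathrm{GL}_2(K_\infty)/K_\infty^\times \mathrm{GL}_2(\mathcal{O}_\infty)$ and oriented edges $E(\mathcal{T})=\mathrm{GL}_2(K_\infty)/K_\infty^\times\mathcal{I}$, where $\mathcal{I}$ is the Iwahori subgroup of matrices in $\mathrm{GL}_2(\mathcal{O}_\infty)$ with lower left entry divisible by $\pi$; the edge $e$ of $g$ has as origin $o(e)$ the vertex of $g$, and its opposite $\overline{e}$ is the edge of $g\begin{pmatrix}0&1\\ \pi&0\end{pmatrix}$. For a commutative ring $R$, let $\mathcal{H}_0(\mathfrak{n},R)$ be the $R$-module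 of cuspidal harmonic cochains for $\Gamma_0(\mathfrak{n})$, i.e. of maps $F:E(\mathcal{T})\to R$ with $F(e)+F(\overline{e})=0$ for all $e$, $\sum_{o(e)=v}F(e)=0$ for all vertices $v$, $F(\gamma e)=F(e)$ for all $\gamma\in\Gamma_0(\mathfrak{n})$, and which are finitely supported on the edges of $\Gamma_0(\mathfrak{n})\backslash\mathcal{T}$. Let $\mathcal{H}_{0,0}(\mathfrak{n},R)$ be the image of $\mathcal{H}_0(\mathfrak{n},\mathbb{Z})\otimes R$ in $\mathcal{H}_0(\mathfrak{n},R)$. For an ideal $\mathfrak{p}$, the Hecke operator $T_\mathfrak{p}$ on $\mathcal{H}_0(\mathfrak{n},R)$ is $(T_\mathfrak{p}F)(e)=\sum F\!\left(\begin{pmatrix}a&b\\0&d\end{pmatrix}e\right)$, the sum being over $a,b,d\in A$ with $a,d$ monic, $(ad)=\mathfrak{p}$, $(a)+\mathfrak{n}=A$ and $\deg b<\deg d$. Let $\mathbb{T}(\mathfrak{n},\mathbb{Z})\subset\mathrm{End}(\mathcal{H}_0(\mathfrak{n},\mathbb{Z}))$ be the $\mathbb{Z}$-subalgebra generated by all $T_\mathfrak{p}$,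 and $\mathbb{T}(\mathfrak{n},\mathbb{F}_p)=\mathbb{T}(\mathfrak{n},\mathbb{Z})\otimes_{\mathbb{Z}}\mathbb{F}_p$. Let $\eta_0:\mathbb{F}_p\to\mathbb{C}^\times$ be a non-trivial additive character and let $\eta\left(\sum_k a_k\pi^k\right)=\eta_0(\mathrm{Tr}_{\mathbb{F}_q/\mathbb{F}_p}(a_1))$ on $K_\infty$. For $F\in\mathcal{H}_0(\mathfrak{n},\mathbb{Z})$, the Fourier coefficient $$c_1(F)=q^{-1}\sum_{u\in\pi\mathcal{O}_\infty/\pi^2\mathcal{O}_\infty}F\!\left(\begin{pmatrix}\pi^2&u\\0&1\end{pmatrix}\right)\eta(-u)$$ with respect to the trivial ideal is an integer. The pairing $(\theta,F)\mapsto c_1(\theta F)$ reduces modulo $p$ to an $\mathbb{F}_p$-bilinear pairing $$\varphi_{\mathrm{HC},\mathbb{F}_p}:\mathbb{T}(\mathfrak{n},\mathbb{F}_p)\times\mathcal{H}_{0,0}(\mathfrak{n},\mathbb{F}_p)\to\mathbb{F}_p,\qquad(\theta\bmod p,\,F\bmod p)\mapsto c_1(\theta F)\bmod p.$$ **Proposition.**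 The left kernel of $\varphi_{\mathrm{HC},\mathbb{F}_p}$ contains the following elements: 1. for any $d\ge 1$, $\displaystyle\sum_{\deg\mathfrak{p}\le d}T_\mathfrak{p}$; 2. for any $d\ge 2$, $\displaystyle\sum_{\deg\mathfrak{p}=d}T_\mathfrak{p}$, where the sums are over all non-zero ideals $\mathfrak{p}$ of $A$ (not only prime ones) of the given degree. -/

import Mathlib

open scoped Polynomial PowerSeries LaurentSeries TensorProduct

namespace FunctionFieldHarmonic

noncomputable section

open Matrix

/-! ### The congruence subgroups -/

/-- The group of invertible `2 × 2` matrices over a commutative ring whose lower left entry lies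
in the ideal `I`. -/
def congruenceSubgroup {R : Type*} [CommRing R] (I : Ideal R) : Subgroup (GL (Fin 2) R) where
  carrier := {g | g 1 0 ∈ I}
  one_mem' := by simp
  mul_mem' := by
    intro a b ha hb
    simp only [Set.mem_ofPred_eq, GeneralLinearGroup.coe_mul, Matrix.mul_apply,
      Fin.sum_univ_two] at ha hb ⊢
    exact I.add_mem (I.mul_mem_right _ ha) (I.mul_mem_left _ hb)
  inv_mem' := by
    intro a ha
    simp only [Set.mem_ofPred_eq] at ha ⊢
    rw [GeneralLinearGroup.coe_inv, Matrix.inv_def, Matrix.adjugate_fin_two]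
    simp only [Matrix.smul_apply, Matrix.of_apply, Matrix.cons_val', Matrix.cons_val_one,
      Matrix.cons_val_zero, Matrix.cons_val_fin_one, smul_eq_mul]
    exact I.mul_mem_left _ (I.neg_mem ha)

theorem mem_congruenceSubgroup {R : Type*} [CommRing R] {I : Ideal R} {g : GL (Fin 2) R} :
    g ∈ congruenceSubgroup I ↔ g 1 0 ∈ I := Iff.rfl

variable (Fq : Type*) [Field Fq]

/-- The uniformizer `π = 1 / T` of the field `Fq((π))`, the completion of `Fq(T)` at infinity. -/
def unif : Fq⸨X⸩ := HahnSeries.single 1 1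

/-- The embedding of `A = Fq[T]` in `Fq((π))` which sends `T` to `π⁻¹`. -/
def polyEmb : Fq[X] →+* Fq⸨X⸩ :=
  Polynomial.eval₂RingHom HahnSeries.C (HahnSeries.single (-1) 1)

/-- The inclusion of `GL₂(A)` in `GL₂(Fq((π)))`. -/
def polyGL : GL (Fin 2) Fq[X] →* GL (Fin 2) Fq⸨X⸩ := GeneralLinearGroup.map (polyEmb Fq)

/-- The group `Γ₀(𝔫)`, as a subgroup of `GL₂(Fq((π)))`. -/
def Gamma0 {Fq : Type*} [Field Fq] (𝔫 : Ideal Fq[X]) : Subgroup (GL (Fin 2) Fq⸨X⸩) :=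
  (congruenceSubgroup 𝔫).map (polyGL Fq)

/-! ### The Bruhat-Tits tree of `PGL₂(Fq((π)))` -/

/-- The inclusion of `GL₂(Fq[[π]])` in `GL₂(Fq((π)))`. -/
def integralGL : GL (Fin 2) Fq⟦X⟧ →* GL (Fin 2) Fq⸨X⸩ :=
  GeneralLinearGroup.map (HahnSeries.ofPowerSeries ℤ Fq)

/-- The subgroup of scalar matrices of `GL₂(Fq((π)))`. -/
def scalarSubgroup : Subgroup (GL (Fin 2) Fq⸨X⸩) :=
  (GeneralLinearGroup.scalar (Fin 2) : (Fq⸨X⸩)ˣ →* GL (Fin 2) Fq⸨X⸩).range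

/-- The stabilizer of the standard vertex: scalar matrices times `GL₂(Fq[[π]])`. -/
def vertexSubgroup : Subgroup (GL (Fin 2) Fq⸨X⸩) :=
  scalarSubgroup Fq ⊔ (integralGL Fq).range

/-- The stabilizer of the standard oriented edge: scalar matrices times the Iwahori subgroup. -/
def edgeSubgroup : Subgroup (GL (Fin 2) Fq⸨X⸩) :=
  scalarSubgroup Fq ⊔
    (congruenceSubgroup (Ideal.span {(PowerSeries.X : Fq⟦X⟧)})).map (integralGL Fq)

/-- The vertices of the Bruhat-Tits tree. -/
abbrev Vertex : Type _ := GL (Fin 2) Fq⸨X⸩ ⧸ vertexSubgroup Fq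

/-- The oriented edges of the Bruhat-Tits tree. -/
abbrev Edge : Type _ := GL (Fin 2) Fq⸨X⸩ ⧸ edgeSubgroup Fq

theorem edgeSubgroup_le : edgeSubgroup Fq ≤ vertexSubgroup Fq :=
  sup_le_sup_left (Subgroup.map_le_range _ _) _

instance scalarSubgroup_normal : (scalarSubgroup Fq).Normal where
  conj_mem := by
    rintro _ ⟨u, rfl⟩ g
    refine ⟨u, ?_⟩
    rw [← GeneralLinearGroup.scalar_commute]
    simp

variable {Fq}

theorem mem_vertexSubgroup {g : GL (Fin 2) Fq⸨X⸩} : g ∈ vertexSubgroup Fq ↔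
    ∃ z k, GeneralLinearGroup.scalar (Fin 2) z * integralGL Fq k = g := by
  rw [vertexSubgroup, Subgroup.mem_sup_of_normal_left]
  constructor
  · rintro ⟨_, ⟨z, rfl⟩, _, ⟨k, rfl⟩, h⟩
    exact ⟨z, k, h⟩
  · rintro ⟨z, k, h⟩
    exact ⟨_, ⟨z, rfl⟩, _, ⟨k, rfl⟩, h⟩

theorem mem_edgeSubgroup {g : GL (Fin 2) Fq⸨X⸩} : g ∈ edgeSubgroup Fq ↔
    ∃ z, ∃ k : GL (Fin 2) Fq⟦X⟧, PowerSeries.X ∣ k 1 0 ∧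
      GeneralLinearGroup.scalar (Fin 2) z * integralGL Fq k = g := by
  rw [edgeSubgroup, Subgroup.mem_sup_of_normal_left]
  constructor
  · rintro ⟨_, ⟨z, rfl⟩, _, ⟨k, hk, rfl⟩, h⟩
    exact ⟨z, k, Ideal.mem_span_singleton.1 hk, h⟩
  · rintro ⟨z, k, hk, h⟩
    exact ⟨_, ⟨z, rfl⟩, _, ⟨k, Ideal.mem_span_singleton.2 hk, rfl⟩, h⟩

/-- The origin of the edge represented by `g` is the vertex represented by `g`. -/
def origin : Edge Fq → Vertex Fq := Subgroup.quotientMapOfLE (edgeSubgroup_le Fq)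

/-- The matrix with rows `(0, 1)` and `(π, 0)`. -/
def flipMatrix : GL (Fin 2) Fq⸨X⸩ :=
  GeneralLinearGroup.mkOfDetNeZero !![0, 1; unif Fq, 0] (by simp [unif, Matrix.det_fin_two])

theorem flip_mem {g : GL (Fin 2) Fq⸨X⸩} (hg : g ∈ edgeSubgroup Fq) :
    flipMatrix⁻¹ * g * flipMatrix ∈ edgeSubgroup Fq := by
  obtain ⟨z, k, ⟨c, hc⟩, rfl⟩ := mem_edgeSubgroup.1 hg
  have hdet : IsUnit (!![k 1 1, c; PowerSeries.X * k 0 1, k 0 0] : Matrix _ _ Fq⟦X⟧).det := by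
    have h := (GeneralLinearGroup.det k).isUnit
    rw [GeneralLinearGroup.val_det_apply, Matrix.det_fin_two, hc] at h
    rw [Matrix.det_fin_two]
    convert h using 1
    simp; ring
  refine mem_edgeSubgroup.2 ⟨z, GeneralLinearGroup.mk'' _ hdet, ⟨k 0 1, rfl⟩, ?_⟩
  rw [eq_comm, mul_assoc, inv_mul_eq_iff_eq_mul, ← mul_assoc, ← GeneralLinearGroup.scalar_commute,
    mul_assoc, mul_assoc]
  congr 1
  have hX : HahnSeries.ofPowerSeries ℤ Fq PowerSeries.X = unif Fq := by
    simp [unif]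
  apply GeneralLinearGroup.ext
  intro i j
  fin_cases i <;> fin_cases j <;>
    simp [flipMatrix, integralGL, Matrix.mul_apply, Fin.sum_univ_two,
      GeneralLinearGroup.mkOfDetNeZero, GeneralLinearGroup.mk'', hc, hX, mul_comm,
      GeneralLinearGroup.mk', Matrix.unitOfDetInvertible, Matrix.nonsingInvUnit]

/-- The edge with opposite orientation: the class of `g` goes to the class of
`g * !![0, 1; π, 0]`. -/
def reverse : Edge Fq → Edge Fq :=
  Quotient.map' (fun g => g * flipMatrix) (by
    intro a b h
    rw [QuotientGroup.leftRel_apply] at h ⊢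
    simpa [mul_assoc] using flip_mem h)

theorem reverse_smul (g : GL (Fin 2) Fq⸨X⸩) (e : Edge Fq) : reverse (g • e) = g • reverse e := by
  induction e using QuotientGroup.induction_on with
  | _ h => exact congrArg (QuotientGroup.mk (s := edgeSubgroup Fq)) (mul_assoc g h flipMatrix)

theorem origin_smul (g : GL (Fin 2) Fq⸨X⸩) (e : Edge Fq) : origin (g • e) = g • origin e := by
  induction e using QuotientGroup.induction_on with
  | _ h => rfl

theorem integralGL_mem_edgeSubgroup {k : GL (Fin 2) Fq⟦X⟧} (hk : PowerSeries.X ∣ k 1 0) :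
    integralGL Fq k ∈ edgeSubgroup Fq :=
  mem_edgeSubgroup.2 ⟨1, k, hk, by simp⟩

/-- A vertex is the origin of finitely many edges. -/
instance finite_edges [Finite Fq] (v : Vertex Fq) : Finite {e : Edge Fq // origin e = v} := by
  induction v using QuotientGroup.induction_on with
  | _ g =>
  let f : GL (Fin 2) Fq⟦X⟧ → Edge Fq := fun k => QuotientGroup.mk (g * integralGL Fq k)
  let r : GL (Fin 2) Fq⟦X⟧ → GL (Fin 2) Fq :=
    GeneralLinearGroup.map (PowerSeries.constantCoeff (R := Fq))
  have hf : ∀ k k', r k = r k' → f k = f k' := by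
    intro k k' h
    have h1 : g * integralGL Fq k' = g * integralGL Fq k * integralGL Fq (k⁻¹ * k') := by
      rw [map_mul, map_inv]; group
    have h2 : integralGL Fq (k⁻¹ * k') ∈ edgeSubgroup Fq := by
      apply integralGL_mem_edgeSubgroup
      rw [PowerSeries.X_dvd_iff]
      have h3 : r (k⁻¹ * k') = 1 := by
        simp only [r] at h ⊢
        rw [map_mul, map_inv, h, inv_mul_cancel]
      have h4 := congrArg (fun x : GL (Fin 2) Fq => x 1 0) h3
      simp only [r, GeneralLinearGroup.map_apply] at h4
      simpa using h4
    simp only [f]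
    rw [h1, QuotientGroup.mk_mul_of_mem _ h2]
  have hfin : (Set.range f).Finite := by
    classical
    have : Set.range f ⊆ Set.range (fun y : Set.range r => f y.2.choose) := by
      rintro _ ⟨k, rfl⟩
      exact ⟨⟨r k, k, rfl⟩, hf _ _ (Exists.choose_spec (⟨k, rfl⟩ : r k ∈ Set.range r))⟩
    exact (Set.finite_range _).subset this
  suffices h : {e : Edge Fq | origin e = (g : Vertex Fq)} ⊆ Set.range f from
    (hfin.subset h).to_subtype
  intro e he
  induction e using QuotientGroup.induction_on with
  | _ h =>
  have he' : ((g : GL (Fin 2) Fq⸨X⸩) : Vertex Fq) = (h : Vertex Fq) := he.symm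
  rw [QuotientGroup.eq] at he'
  obtain ⟨z, k, hk⟩ := mem_vertexSubgroup.1 he'
  refine ⟨k, ?_⟩
  have h1 : h = g * integralGL Fq k * GeneralLinearGroup.scalar (Fin 2) z := by
    rw [← GeneralLinearGroup.scalar_commute, ← mul_assoc, GeneralLinearGroup.scalar_commute,
      mul_assoc, hk]; group
  have h2 : GeneralLinearGroup.scalar (Fin 2) z ∈ edgeSubgroup Fq :=
    Subgroup.mem_sup_left ⟨z, rfl⟩
  rw [h1, QuotientGroup.mk_mul_of_mem _ h2]

/-! ### Cuspidal harmonic cochains -/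

section Cochains

variable {R : Type*} [CommRing R]

/-- Harmonic cochains with values in `R`. Each sum is finite by `finite_edges`. -/
def IsHarmonic (F : Edge Fq → R) : Prop :=
  (∀ e, F e + F (reverse e) = 0) ∧
    ∀ v : Vertex Fq, ∑ᶠ e : {e : Edge Fq // origin e = v}, F e = 0

/-- `Γ₀(𝔫)`-invariance of a function on the edges. -/
def IsInvariant (𝔫 : Ideal Fq[X]) (F : Edge Fq → R) : Prop :=
  ∀ γ ∈ Gamma0 𝔫, ∀ e, F (γ • e) = F e

/-- The edge of the quotient graph `Γ₀(𝔫) \ 𝒯` below an edge of the tree. -/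
def quotientEdge (𝔫 : Ideal Fq[X]) (e : Edge Fq) :
    MulAction.orbitRel.Quotient (Gamma0 𝔫) (Edge Fq) :=
  Quotient.mk _ e

/-- Finite support on the edges of the quotient graph. -/
def IsCuspidal (𝔫 : Ideal Fq[X]) (F : Edge Fq → R) : Prop :=
  (quotientEdge 𝔫 '' Function.support F).Finite

variable (R) in
/-- The module `H₀(𝔫, R)` of cuspidal `Γ₀(𝔫)`-invariant harmonic cochains with values in `R`. -/
def cuspHarm [Finite Fq] (𝔫 : Ideal Fq[X]) : Submodule R (Edge Fq → R) where
  carrier := {F | IsHarmonic F ∧ IsInvariant 𝔫 F ∧ IsCuspidal 𝔫 F}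
  zero_mem' := by
    refine ⟨⟨fun e => by simp, fun v => by simp⟩, fun γ _ e => rfl, ?_⟩
    simp [IsCuspidal]
  add_mem' := by
    rintro F G ⟨⟨h1, h2⟩, h3, h4⟩ ⟨⟨k1, k2⟩, k3, k4⟩
    refine ⟨⟨fun e => ?_, fun v => ?_⟩, fun γ hγ e => ?_, ?_⟩
    · simp only [Pi.add_apply]
      linear_combination h1 e + k1 e
    · simp only [Pi.add_apply]
      rw [finsum_add_distrib (Set.toFinite _) (Set.toFinite _), h2, k2, add_zero]
    · simp only [Pi.add_apply, h3 γ hγ, k3 γ hγ]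
    · refine (Set.Finite.union h4 k4).subset ?_
      rw [← Set.image_union]
      exact Set.image_mono (Function.support_add F G)
  smul_mem' := by
    rintro c F ⟨⟨h1, h2⟩, h3, h4⟩
    refine ⟨⟨fun e => ?_, fun v => ?_⟩, fun γ hγ e => ?_, ?_⟩
    · simp only [Pi.smul_apply, ← smul_add, h1, smul_zero]
    · simp only [Pi.smul_apply, smul_eq_mul]
      have : Fintype {e : Edge Fq // origin e = v} := Fintype.ofFinite _
      have h5 := h2 v
      rw [finsum_eq_sum_of_fintype] at h5 ⊢
      rw [← Finset.mul_sum, h5, mul_zero]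
    · simp only [Pi.smul_apply, h3 γ hγ]
    · exact Set.Finite.subset h4 (Set.image_mono (Function.support_const_smul_subset c F))

end Cochains

/-! ### Hecke operators -/

theorem polyEmb_coeff (P : Fq[X]) (i : ℕ) : (polyEmb Fq P).coeff (-(i : ℤ)) = P.coeff i := by
  induction P using Polynomial.induction_on' with
  | add P Q hP hQ => simp [hP, hQ]
  | monomial m a =>
    simp only [polyEmb, Polynomial.coe_eval₂RingHom, Polynomial.eval₂_monomial,
      HahnSeries.single_pow, one_pow, HahnSeries.C_apply, HahnSeries.single_mul_single]
    rw [HahnSeries.coeff_single, Polynomial.coeff_monomial]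
    by_cases h : m = i
    · subst h; simp
    · rw [if_neg (by simpa using fun h' => h h'.symm), if_neg h]

theorem polyEmb_injective : Function.Injective (polyEmb Fq) := by
  intro P Q h
  ext i
  rw [← polyEmb_coeff, ← polyEmb_coeff, h]

/-- A matrix over `A` with non-zero determinant, as an element of `GL₂(Fq((π)))`. -/
def matGL (m : Matrix (Fin 2) (Fin 2) Fq[X]) (hm : m.det ≠ 0) : GL (Fin 2) Fq⸨X⸩ :=
  GeneralLinearGroup.mkOfDetNeZero (m.map (polyEmb Fq)) (by
    have h := RingHom.map_det (polyEmb Fq) m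
    rw [RingHom.mapMatrix_apply] at h
    rw [← h]
    exact (map_ne_zero_iff _ polyEmb_injective).2 hm)

/-- The set `S_𝔭` of upper triangular matrices which defines the Hecke operator `T_𝔭` in
level `𝔫`. -/
def heckeSet (𝔫 𝔭 : Ideal Fq[X]) : Set (Matrix (Fin 2) (Fin 2) Fq[X]) :=
  {s | s 1 0 = 0 ∧ (s 0 0).Monic ∧ (s 1 1).Monic ∧ Ideal.span {s 0 0 * s 1 1} = 𝔭 ∧
    Ideal.span {s 0 0} ⊔ 𝔫 = ⊤ ∧ (s 0 1).degree < (s 1 1).degree}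

theorem heckeSet_det_ne_zero {𝔫 𝔭 : Ideal Fq[X]} {s : Matrix (Fin 2) (Fin 2) Fq[X]}
    (hs : s ∈ heckeSet 𝔫 𝔭) : s.det ≠ 0 := by
  rw [Matrix.det_fin_two, hs.1, mul_zero, sub_zero]
  exact (hs.2.1.mul hs.2.2.1).ne_zero

theorem finite_degree_le [Finite Fq] (N : ℕ) : {P : Fq[X] | P.natDegree ≤ N}.Finite := by
  have h1 : Finite (Polynomial.degreeLT Fq (N + 1)) :=
    Finite.of_equiv _ (Polynomial.degreeLTEquiv Fq (N + 1)).toEquiv.symm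
  have h2 : {P : Fq[X] | P.natDegree ≤ N} ⊆ (Polynomial.degreeLT Fq (N + 1) : Set Fq[X]) := by
    intro P hP
    rw [SetLike.mem_coe, Polynomial.mem_degreeLT]
    refine lt_of_le_of_lt Polynomial.degree_le_natDegree ?_
    exact_mod_cast Nat.lt_succ_of_le hP
  exact (Set.toFinite _).subset h2

instance finite_heckeSet [Finite Fq] (𝔫 𝔭 : Ideal Fq[X]) : Finite (heckeSet 𝔫 𝔭) := by
  by_cases hne : (heckeSet 𝔫 𝔭).Nonempty
  swap
  · rw [Set.not_nonempty_iff_eq_empty.1 hne]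
    infer_instance
  obtain ⟨s₀, hs₀⟩ := hne
  set N := (s₀ 0 0 * s₀ 1 1).natDegree
  have h : (heckeSet 𝔫 𝔭) ⊆ {s | ∀ i, s i ∈ {r : Fin 2 → Fq[X] | ∀ j, r j ∈
      {P : Fq[X] | P.natDegree ≤ N}}} := by
    intro s hs
    have hN : (s 0 0).natDegree + (s 1 1).natDegree = N := by
      rw [← hs.2.1.natDegree_mul hs.2.2.1]
      have : Associated (s 0 0 * s 1 1) (s₀ 0 0 * s₀ 1 1) := by
        rw [← Ideal.span_singleton_eq_span_singleton, hs.2.2.2.1, hs₀.2.2.2.1]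
      exact Polynomial.natDegree_eq_of_degree_eq (Polynomial.degree_eq_degree_of_associated this)
    have h01 : (s 0 1).natDegree ≤ (s 1 1).natDegree :=
      Polynomial.natDegree_le_natDegree hs.2.2.2.2.2.le
    simp only [Set.mem_ofPred_eq, Fin.forall_fin_two]
    refine ⟨⟨by omega, by omega⟩, ?_, by omega⟩
    rw [hs.1]; simp
  exact ((Set.Finite.pi' fun _ => Set.Finite.pi' fun _ => finite_degree_le N).subset h).to_subtype

instance fintypeHeckeSet [Finite Fq] (𝔫 𝔭 : Ideal Fq[X]) : Fintype (heckeSet 𝔫 𝔭) :=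
  Fintype.ofFinite _

/-- The element of `GL₂(Fq((π)))` given by an element of `S_𝔭`. -/
def heckeGL {𝔫 𝔭 : Ideal Fq[X]} (s : heckeSet 𝔫 𝔭) : GL (Fin 2) Fq⸨X⸩ :=
  matGL s.1 (heckeSet_det_ne_zero s.2)

/-- The formula `(T_𝔭 F)(e) = ∑_{s ∈ S_𝔭} F(s e)`. -/
def heckeFun [Finite Fq] {R : Type*} [CommRing R] (𝔫 𝔭 : Ideal Fq[X]) (F : Edge Fq → R) :
    Edge Fq → R :=
  fun e => ∑ s : heckeSet 𝔫 𝔭, F (heckeGL s • e)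

/-! ### Hecke operators preserve cuspidal harmonic cochains -/

theorem span_sup_eq_top_iff {𝔫 : Ideal Fq[X]} {a : Fq[X]} :
    Ideal.span {a} ⊔ 𝔫 = ⊤ ↔ ∃ x, x * a - 1 ∈ 𝔫 := by
  rw [Ideal.eq_top_iff_one, Submodule.mem_sup]
  constructor
  · rintro ⟨y, hy, z, hz, h⟩
    obtain ⟨x, rfl⟩ := Ideal.mem_span_singleton'.1 hy
    refine ⟨x, ?_⟩
    have : x * a - 1 = -z := by linear_combination h
    rw [this]
    exact 𝔫.neg_mem hz
  · rintro ⟨x, hx⟩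
    exact ⟨x * a, Ideal.mem_span_singleton'.2 ⟨x, rfl⟩, -(x * a - 1), 𝔫.neg_mem hx, by ring⟩

/-- Matrices with determinant generating `𝔭`, lower left entry in `𝔫` and upper left entry
prime to `𝔫`. -/
def heckeMat (𝔫 𝔭 : Ideal Fq[X]) : Set (Matrix (Fin 2) (Fin 2) Fq[X]) :=
  {m | Ideal.span {m.det} = 𝔭 ∧ m 1 0 ∈ 𝔫 ∧ Ideal.span {m 0 0} ⊔ 𝔫 = ⊤}

theorem heckeSet_subset (𝔫 𝔭 : Ideal Fq[X]) : heckeSet 𝔫 𝔭 ⊆ heckeMat 𝔫 𝔭 := by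
  rintro s ⟨h1, -, -, h4, h5, -⟩
  refine ⟨?_, ?_, h5⟩
  · rw [Matrix.det_fin_two, h1, mul_zero, sub_zero, h4]
  · rw [h1]; exact 𝔫.zero_mem

theorem heckeMat_mul {𝔫 𝔭 : Ideal Fq[X]} {m : Matrix (Fin 2) (Fin 2) Fq[X]}
    (hm : m ∈ heckeMat 𝔫 𝔭) {γ : GL (Fin 2) Fq[X]} (hγ : γ ∈ congruenceSubgroup 𝔫) :
    m * γ.1 ∈ heckeMat 𝔫 𝔭 := by
  obtain ⟨h1, h2, h3⟩ := hm
  rw [mem_congruenceSubgroup] at hγ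
  obtain ⟨v, hv⟩ := (GeneralLinearGroup.det γ).isUnit
  refine ⟨?_, ?_, ?_⟩
  · rw [← h1, Matrix.det_mul]
    exact Ideal.span_singleton_mul_right_unit (GeneralLinearGroup.det γ).isUnit _
  · rw [Matrix.mul_apply, Fin.sum_univ_two]
    exact 𝔫.add_mem (𝔫.mul_mem_right _ h2) (𝔫.mul_mem_left _ hγ)
  · rw [span_sup_eq_top_iff] at h3 ⊢
    obtain ⟨x, hx⟩ := h3
    have hd : (v : Fq[X]) = γ 0 0 * γ 1 1 - γ 0 1 * γ 1 0 := by
      rw [hv, GeneralLinearGroup.val_det_apply, Matrix.det_fin_two]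
    have hi : (v : Fq[X]) * (v⁻¹ : Fq[X]ˣ) = 1 := v.mul_inv
    refine ⟨x * γ 1 1 * (v⁻¹ : Fq[X]ˣ), ?_⟩
    rw [Matrix.mul_apply, Fin.sum_univ_two]
    have : x * γ 1 1 * (v⁻¹ : Fq[X]ˣ) * (m 0 0 * γ 0 0 + m 0 1 * γ 1 0) - 1 =
        (x * m 0 0 - 1) + γ 1 0 * (x * (v⁻¹ : Fq[X]ˣ) * (m 0 1 * γ 1 1 + m 0 0 * γ 0 1)) := by
      rw [hd] at hi
      linear_combination (x * m 0 0) * hi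
    rw [this]
    exact 𝔫.add_mem hx (𝔫.mul_mem_right _ hγ)

theorem exists_heckeSet {𝔫 𝔭 : Ideal Fq[X]} (h𝔭 : 𝔭 ≠ ⊥) {m : Matrix (Fin 2) (Fin 2) Fq[X]}
    (hm : m ∈ heckeMat 𝔫 𝔭) :
    ∃ γ ∈ congruenceSubgroup 𝔫, ∃ s ∈ heckeSet 𝔫 𝔭, m = γ.1 * s := by
  classical
  obtain ⟨h1, h2, h3⟩ := hm
  have hdet : m.det ≠ 0 := by
    intro h; rw [h] at h1; apply h𝔭; rw [← h1]; simp
  rw [Matrix.det_fin_two] at hdet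
  obtain ⟨a', ha'⟩ := EuclideanDomain.gcd_dvd_left (m 0 0) (m 1 0)
  obtain ⟨c', hc'⟩ := EuclideanDomain.gcd_dvd_right (m 0 0) (m 1 0)
  have hbez := EuclideanDomain.gcd_eq_gcd_ab (m 0 0) (m 1 0)
  set g := EuclideanDomain.gcd (m 0 0) (m 1 0)
  set x := EuclideanDomain.gcdA (m 0 0) (m 1 0)
  set y := EuclideanDomain.gcdB (m 0 0) (m 1 0)
  have hg : g ≠ 0 := by
    intro h; rw [h, zero_mul] at ha' hc'; apply hdet; rw [ha', hc']; ring
  have hxy : a' * x + c' * y = 1 := by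
    apply mul_left_cancel₀ hg
    linear_combination -hbez - x * ha' - y * hc'
  set D := a' * m 1 1 - c' * m 0 1 with hD
  have hgD : m.det = g * D := by
    rw [Matrix.det_fin_two, hD]; linear_combination m 1 1 * ha' - m 0 1 * hc'
  have hD0 : D ≠ 0 := by
    intro h; rw [← Matrix.det_fin_two, hgD, h, mul_zero] at hdet; exact hdet rfl
  set B := x * m 0 1 + y * m 1 1 with hB
  have hlg : g.leadingCoeff ≠ 0 := Polynomial.leadingCoeff_ne_zero.2 hg
  have hlD : D.leadingCoeff ≠ 0 := Polynomial.leadingCoeff_ne_zero.2 hD0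
  set u : Fq[X] := Polynomial.C g.leadingCoeff
  set w : Fq[X] := Polynomial.C D.leadingCoeff
  set u' : Fq[X] := Polynomial.C g.leadingCoeff⁻¹
  set w' : Fq[X] := Polynomial.C D.leadingCoeff⁻¹
  have hu : u * u' = 1 := by simp only [u, u', ← Polynomial.C_mul, mul_inv_cancel₀ hlg]; simp
  have hw : w * w' = 1 := by simp only [w, w', ← Polynomial.C_mul, mul_inv_cancel₀ hlD]; simp
  have hgm : (g * u').Monic := Polynomial.monic_mul_leadingCoeff_inv hg
  have hDm : (D * w').Monic := Polynomial.monic_mul_leadingCoeff_inv hD0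
  set Q := (B * u') /ₘ (D * w')
  set r := (B * u') %ₘ (D * w') with hr
  have hQr : r + D * w' * Q = B * u' := Polynomial.modByMonic_add_div _ _
  have hγd : (!![a' * u, a' * u * Q - y * w; c' * u, c' * u * Q + x * w] :
      Matrix (Fin 2) (Fin 2) Fq[X]).det = u * w := by
    rw [Matrix.det_fin_two]; simp
    linear_combination u * w * hxy
  have hγu : IsUnit (!![a' * u, a' * u * Q - y * w; c' * u, c' * u * Q + x * w] :
      Matrix (Fin 2) (Fin 2) Fq[X]).det := by
    rw [hγd]
    exact IsUnit.of_mul_eq_one (u' * w') (by linear_combination w * w' * hu + hw)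
  obtain ⟨z, hz⟩ := span_sup_eq_top_iff.1 h3
  have hgn : g * (a' * z) - 1 ∈ 𝔫 := by
    rw [ha'] at hz; convert hz using 1; ring
  refine ⟨GeneralLinearGroup.mk'' _ hγu, ?_, !![g * u', r; 0, D * w'], ?_, ?_⟩
  · rw [mem_congruenceSubgroup]
    change c' * u ∈ 𝔫
    have : c' * u = m 1 0 * (a' * z * u) - (g * (a' * z) - 1) * (c' * u) := by
      rw [hc']; ring
    rw [this]
    exact 𝔫.sub_mem (𝔫.mul_mem_right _ h2) (𝔫.mul_mem_right _ hgn)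
  · refine ⟨rfl, hgm, hDm, ?_, ?_, Polynomial.degree_modByMonic_lt _ hDm⟩
    · change Ideal.span {g * u' * (D * w')} = 𝔭
      rw [← h1, hgD]
      rw [show g * u' * (D * w') = g * D * (u' * w') by ring]
      exact Ideal.span_singleton_mul_right_unit
        (IsUnit.of_mul_eq_one (u * w) (by linear_combination w * w' * hu + hw)) _
    · rw [span_sup_eq_top_iff]
      refine ⟨a' * z * u, ?_⟩
      change a' * z * u * (g * u') - 1 ∈ 𝔫
      have : a' * z * u * (g * u') - 1 = g * (a' * z) - 1 := by
        linear_combination a' * z * g * hu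
      rw [this]; exact hgn
  · change m = !![a' * u, a' * u * Q - y * w; c' * u, c' * u * Q + x * w] *
      !![g * u', r; 0, D * w']
    ext1 i j
    fin_cases i <;> fin_cases j
    · simp [Matrix.mul_apply, Fin.sum_univ_two]
      linear_combination ha' - a' * g * hu
    · simp [Matrix.mul_apply, Fin.sum_univ_two]
      linear_combination -(a' * u) * hQr + y * D * hw - a' * B * hu - m 0 1 * hxy + y * hD - a' * hB
    · simp [Matrix.mul_apply, Fin.sum_univ_two]
      linear_combination hc' - c' * g * hu
    · simp [Matrix.mul_apply, Fin.sum_univ_two]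
      linear_combination -(c' * u) * hQr - x * D * hw - c' * B * hu - m 1 1 * hxy - x * hD - c' * hB

theorem heckeSet_unique {𝔫 𝔭 : Ideal Fq[X]} {s s' : Matrix (Fin 2) (Fin 2) Fq[X]}
    (hs : s ∈ heckeSet 𝔫 𝔭) (hs' : s' ∈ heckeSet 𝔫 𝔭) (γ : GL (Fin 2) Fq[X])
    (h : γ.1 * s = s') : s = s' := by
  obtain ⟨h1, h2, h3, -, -, h6⟩ := hs
  obtain ⟨k1, k2, k3, -, -, k6⟩ := hs'
  have e00 : γ 0 0 * s 0 0 = s' 0 0 := by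
    rw [← h, Matrix.mul_apply, Fin.sum_univ_two, h1]; ring
  have e10 : γ 1 0 = 0 := by
    have : γ 1 0 * s 0 0 = 0 := by
      rw [← k1, ← h, Matrix.mul_apply, Fin.sum_univ_two, h1]; ring
    exact (mul_eq_zero.1 this).resolve_right h2.ne_zero
  have e11 : γ 1 1 * s 1 1 = s' 1 1 := by
    rw [← h, Matrix.mul_apply, Fin.sum_univ_two, e10]; ring
  have e01 : γ 0 0 * s 0 1 + γ 0 1 * s 1 1 = s' 0 1 := by
    rw [← h, Matrix.mul_apply, Fin.sum_univ_two]
  have hu := (GeneralLinearGroup.det γ).isUnit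
  rw [GeneralLinearGroup.val_det_apply, Matrix.det_fin_two, e10, mul_zero, sub_zero,
    IsUnit.mul_iff] at hu
  have a00 : s 0 0 = s' 0 0 := Polynomial.eq_of_monic_of_associated h2 k2
    ⟨hu.1.unit, by rw [mul_comm]; exact e00⟩
  have a11 : s 1 1 = s' 1 1 := Polynomial.eq_of_monic_of_associated h3 k3
    ⟨hu.2.unit, by rw [mul_comm]; exact e11⟩
  have g00 : γ 0 0 = 1 := mul_right_cancel₀ h2.ne_zero (by rw [e00, a00, one_mul])
  have g01 : γ 0 1 = 0 := by
    by_contra h0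
    have hlt : (γ 0 1 * s 1 1).degree < (s 1 1).degree := by
      have : γ 0 1 * s 1 1 = s' 0 1 - s 0 1 := by rw [← e01, g00]; ring
      rw [this]
      refine lt_of_le_of_lt (Polynomial.degree_sub_le _ _) (max_lt ?_ h6)
      rw [a11]; exact k6
    exact absurd hlt (not_lt.2 (by
      rw [mul_comm]; exact Polynomial.degree_le_mul_left _ h0))
  have a01 : s 0 1 = s' 0 1 := by rw [← e01, g00, g01]; ring
  ext1 i j
  fin_cases i <;> fin_cases j
  exacts [a00, a01, h1.trans k1.symm, a11]

theorem matGL_mul {m m' : Matrix (Fin 2) (Fin 2) Fq[X]} (hm : m.det ≠ 0) (hm' : m'.det ≠ 0)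
    (h : (m * m').det ≠ 0) : matGL (m * m') h = matGL m hm * matGL m' hm' := by
  apply Units.ext
  exact Matrix.map_mul

theorem matGL_coe (γ : GL (Fin 2) Fq[X]) (h : γ.1.det ≠ 0) : matGL γ.1 h = polyGL Fq γ :=
  Units.ext rfl

theorem GL_det_ne_zero (γ : GL (Fin 2) Fq[X]) : γ.1.det ≠ 0 :=
  (GeneralLinearGroup.det γ).isUnit.ne_zero

theorem scalar_smul (z : (Fq⸨X⸩)ˣ) (e : Edge Fq) :
    GeneralLinearGroup.scalar (Fin 2) z • e = e := by
  induction e using QuotientGroup.induction_on with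
  | _ g =>
  change ((GeneralLinearGroup.scalar (Fin 2) z * g : GL (Fin 2) Fq⸨X⸩) : Edge Fq) = g
  rw [GeneralLinearGroup.scalar_commute]
  exact QuotientGroup.mk_mul_of_mem _ (Subgroup.mem_sup_left ⟨z, rfl⟩)

theorem finite_quotient_ideal [Finite Fq] {𝔫 : Ideal Fq[X]} (h𝔫 : 𝔫 ≠ ⊥) :
    Finite (Fq[X] ⧸ 𝔫) := by
  obtain ⟨g, rfl⟩ := (IsPrincipalIdealRing.principal 𝔫).principal
  have hg : g ≠ 0 := by rintro rfl; simp at h𝔫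
  have : Finite {P : Fq[X] | P.natDegree ≤ g.natDegree} := (finite_degree_le _).to_subtype
  refine Finite.of_surjective
    (fun P : {P : Fq[X] | P.natDegree ≤ g.natDegree} =>
      (Ideal.Quotient.mk (Fq[X] ∙ g) P.1)) ?_
  intro q
  obtain ⟨P, rfl⟩ := Ideal.Quotient.mk_surjective q
  refine ⟨⟨P % g, Polynomial.natDegree_le_natDegree (EuclideanDomain.mod_lt P hg).le⟩, ?_⟩
  rw [Ideal.Quotient.eq]
  refine Ideal.mem_span_singleton.2 ⟨-(P / g), ?_⟩
  linear_combination EuclideanDomain.div_add_mod P g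

theorem exists_coset_reps [Finite Fq] {𝔫 : Ideal Fq[X]} (h𝔫 : 𝔫 ≠ ⊥) :
    ∃ t : Set (GL (Fin 2) Fq[X]), t.Finite ∧
      ∀ g, ∃ γ ∈ congruenceSubgroup 𝔫, ∃ r ∈ t, g = γ * r := by
  have := finite_quotient_ideal h𝔫
  let f := GeneralLinearGroup.map (n := Fin 2) (Ideal.Quotient.mk 𝔫)
  have : Finite (GL (Fin 2) (Fq[X] ⧸ 𝔫)) :=
    Finite.of_injective (fun g : GL (Fin 2) (Fq[X] ⧸ 𝔫) => fun i j => g i j)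
      (fun g g' h => GeneralLinearGroup.ext fun i j => congrFun (congrFun h i) j)
  have hle : f.ker ≤ congruenceSubgroup 𝔫 := by
    intro g hg
    rw [mem_congruenceSubgroup, ← Ideal.Quotient.eq_zero_iff_mem]
    have h1 := congrArg (fun x : GL (Fin 2) (Fq[X] ⧸ 𝔫) => x 1 0) (MonoidHom.mem_ker.1 hg)
    simp only [f, GeneralLinearGroup.map_apply] at h1
    simpa using h1
  have : (congruenceSubgroup 𝔫).FiniteIndex := Subgroup.finiteIndex_of_le hle
  have : Finite (GL (Fin 2) Fq[X] ⧸ congruenceSubgroup 𝔫) := inferInstance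
  refine ⟨Set.range (fun q : GL (Fin 2) Fq[X] ⧸ congruenceSubgroup 𝔫 => q.out⁻¹),
    Set.finite_range _, fun g => ?_⟩
  obtain ⟨h, hh⟩ := QuotientGroup.mk_out_eq_mul (congruenceSubgroup 𝔫) g⁻¹
  refine ⟨h, h.2, _, ⟨(g⁻¹ : GL (Fin 2) Fq[X]), rfl⟩, ?_⟩
  change g = h * (Quotient.out _)⁻¹
  rw [hh]; group

section Stability

variable {R : Type*} [CommRing R]

theorem isCuspidal_iff {𝔫 : Ideal Fq[X]} {F : Edge Fq → R} : IsCuspidal 𝔫 F ↔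
    ∃ t : Set (Edge Fq), t.Finite ∧
      ∀ e, F e ≠ 0 → ∃ γ ∈ congruenceSubgroup 𝔫, ∃ e' ∈ t, e = polyGL Fq γ • e' := by
  constructor
  · intro h
    refine ⟨Quotient.out '' (quotientEdge 𝔫 '' Function.support F), h.image _, fun e he => ?_⟩
    have h1 : (MulAction.orbitRel (Gamma0 𝔫) (Edge Fq)) (quotientEdge 𝔫 e).out e :=
      Quotient.mk_out e
    obtain ⟨⟨_, γ, hγ, rfl⟩, h2⟩ := (MulAction.orbitRel _ _).symm h1
    exact ⟨γ, hγ, _, ⟨_, ⟨e, he, rfl⟩, rfl⟩, h2.symm⟩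
  · rintro ⟨t, ht, h⟩
    refine (ht.image (quotientEdge 𝔫)).subset ?_
    rintro _ ⟨e, he, rfl⟩
    obtain ⟨γ, hγ, e', he', rfl⟩ := h e he
    refine ⟨e', he', (Quotient.sound (?_ : MulAction.orbitRel (Gamma0 𝔫) (Edge Fq) _ _)).symm⟩
    exact ⟨⟨_, γ, hγ, rfl⟩, rfl⟩

variable [Finite Fq]

theorem heckeFun_harmonic (𝔫 𝔭 : Ideal Fq[X]) {F : Edge Fq → R} (hF : IsHarmonic F) :
    IsHarmonic (heckeFun 𝔫 𝔭 F) := by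
  refine ⟨fun e => ?_, fun v => ?_⟩
  · simp only [heckeFun, ← Finset.sum_add_distrib, ← reverse_smul, hF.1, Finset.sum_const_zero]
  · simp only [heckeFun]
    have : Fintype {e : Edge Fq // origin e = v} := Fintype.ofFinite _
    rw [finsum_eq_sum_of_fintype, Finset.sum_comm]
    refine Finset.sum_eq_zero fun s _ => ?_
    rw [← finsum_eq_sum_of_fintype, ← hF.2 (heckeGL s • v)]
    let E : {e : Edge Fq // origin e = v} ≃ {e : Edge Fq // origin e = heckeGL s • v} :=
      (MulAction.toPerm (heckeGL s)).subtypeEquiv (fun e => by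
        simp [origin_smul])
    exact finsum_comp_equiv (f := fun e : {e : Edge Fq // origin e = heckeGL s • v} => F e) E

theorem heckeFun_invariant (𝔫 𝔭 : Ideal Fq[X]) {F : Edge Fq → R} (hF : IsInvariant 𝔫 F) :
    IsInvariant 𝔫 (heckeFun 𝔫 𝔭 F) := by
  rintro _ ⟨γ, hγ, rfl⟩ e
  simp only [heckeFun]
  by_cases h𝔭 : 𝔭 = ⊥
  · have : IsEmpty (heckeSet 𝔫 𝔭) := ⟨fun s => by
      have h := s.2.2.2.2.1
      replace h := h.trans h𝔭
      rw [Ideal.span_singleton_eq_bot] at h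
      exact (s.2.2.1.mul s.2.2.2.1).ne_zero h⟩
    simp
  have H : ∀ s : heckeSet 𝔫 𝔭, ∃ s' : heckeSet 𝔫 𝔭, ∃ δ ∈ congruenceSubgroup 𝔫,
      s.1 * γ.1 = δ.1 * s'.1 := by
    intro s
    obtain ⟨δ, hδ, s', hs', h⟩ := exists_heckeSet h𝔭 (heckeMat_mul (heckeSet_subset _ _ s.2) hγ)
    exact ⟨⟨s', hs'⟩, δ, hδ, h⟩
  choose f δ hδ hf using H
  have hinj : Function.Injective f := by
    intro s s' h
    have h1 := hf s
    have h2 := hf s'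
    rw [← h] at h2
    apply Subtype.ext
    refine heckeSet_unique s.2 s'.2 (δ s' * (δ s)⁻¹) ?_
    have h3 : s'.1 = (δ s').1 * (f s).1 * (γ⁻¹).1 := by
      rw [← h2, mul_assoc, Units.mul_inv, mul_one]
    have h4 : (f s).1 = ((δ s)⁻¹).1 * (s.1 * γ.1) := by
      rw [h1, ← mul_assoc, Units.inv_mul, one_mul]
    rw [h3, h4, Units.val_mul]
    simp only [mul_assoc, Units.mul_inv, mul_one]
  have key : ∀ s, F (heckeGL s • polyGL Fq γ • e) = F (heckeGL (f s) • e) := by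
    intro s
    have h0 : (s.1 * γ.1).det ≠ 0 := by
      rw [Matrix.det_mul]
      exact mul_ne_zero (heckeSet_det_ne_zero s.2) (GL_det_ne_zero γ)
    have h1 : heckeGL s * polyGL Fq γ = polyGL Fq (δ s) * heckeGL (f s) := by
      rw [← matGL_coe γ (GL_det_ne_zero γ), ← matGL_coe (δ s) (GL_det_ne_zero _), heckeGL, heckeGL,
        ← matGL_mul _ _ h0, ← matGL_mul _ _ (by rw [← hf s]; exact h0)]
      congr 1
      exact hf s
    rw [← mul_smul, h1, mul_smul]
    exact hF _ ⟨δ s, hδ s, rfl⟩ _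
  simp only [key]
  exact (Equiv.ofBijective f (Finite.injective_iff_bijective.1 hinj)).sum_comp
    (fun s => F (heckeGL s • e))

theorem heckeFun_cuspidal {𝔫 : Ideal Fq[X]} (h𝔫 : 𝔫 ≠ ⊥) (𝔭 : Ideal Fq[X]) {F : Edge Fq → R}
    (hF : IsCuspidal 𝔫 F) : IsCuspidal 𝔫 (heckeFun 𝔫 𝔭 F) := by
  rw [isCuspidal_iff] at hF ⊢
  obtain ⟨t, ht, h⟩ := hF
  obtain ⟨c, hc, hcr⟩ := exists_coset_reps h𝔫
  refine ⟨⋃ r ∈ c, ⋃ s : heckeSet ⊤ 𝔭, (fun e' => (polyGL Fq r * heckeGL s) • e') '' t,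
    hc.biUnion fun r _ => Set.finite_iUnion fun s => ht.image _, fun e he => ?_⟩
  obtain ⟨s, -, hs⟩ := Finset.exists_ne_zero_of_sum_ne_zero he
  obtain ⟨γ, hγ, e', he', heq⟩ := h _ hs
  have hsd := heckeSet_det_ne_zero s.2
  have had : s.1.adjugate.det = s.1.det := by
    rw [Matrix.det_adjugate]; simp
  have h𝔭 : Ideal.span {s.1.det} = 𝔭 := (heckeSet_subset _ _ s.2).1
  have hm : s.1.adjugate * γ.1 ∈ heckeMat ⊤ 𝔭 := by
    refine heckeMat_mul ⟨by rw [had, h𝔭], Submodule.mem_top, sup_top_eq _⟩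
      (Submodule.mem_top : γ 1 0 ∈ (⊤ : Ideal Fq[X]))
  have hbot : 𝔭 ≠ ⊥ := by
    rw [← h𝔭, Ne, Ideal.span_singleton_eq_bot]; exact hsd
  obtain ⟨γ₁, -, s', hs', hfac⟩ := exists_heckeSet hbot hm
  obtain ⟨γ₂, hγ₂, r, hr, rfl⟩ := hcr γ₁
  refine ⟨γ₂, hγ₂, (polyGL Fq r * heckeGL ⟨s', hs'⟩) • e', ?_, ?_⟩
  · simp only [Set.mem_iUnion]
    exact ⟨r, hr, ⟨s', hs'⟩, e', he', rfl⟩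
  · have hadj : s.1.adjugate.det ≠ 0 := by rw [had]; exact hsd
    have h0 : (s.1.adjugate * γ.1).det ≠ 0 := by
      rw [Matrix.det_mul]; exact mul_ne_zero hadj (GL_det_ne_zero γ)
    have e1 : matGL _ hadj * polyGL Fq γ =
        polyGL Fq γ₂ * (polyGL Fq r * heckeGL ⟨s', hs'⟩) := by
      rw [← matGL_coe γ (GL_det_ne_zero γ), ← mul_assoc, ← map_mul,
        ← matGL_coe (γ₂ * r) (GL_det_ne_zero _), heckeGL,
        ← matGL_mul _ _ h0, ← matGL_mul _ _ (by rw [← hfac]; exact h0)]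
      congr 1
    rw [← mul_smul, ← e1, mul_smul, ← heq, ← mul_smul]
    have hz : polyEmb Fq s.1.det ≠ 0 := (map_ne_zero_iff _ polyEmb_injective).2 hsd
    have e2 : matGL _ hadj * heckeGL s = GeneralLinearGroup.scalar (Fin 2) (Units.mk0 _ hz) := by
      apply Units.ext
      change s.1.adjugate.map (polyEmb Fq) * s.1.map (polyEmb Fq) = _
      rw [← Matrix.map_mul, Matrix.adjugate_mul]
      ext1 i j
      by_cases hij : i = j <;>
        simp [GeneralLinearGroup.coe_scalar, hij]
    rw [e2, scalar_smul]

variable (R) in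
/-- The Hecke operator `T_𝔭` on `H₀(𝔫, R)`. -/
def hecke (𝔫 : Ideal Fq[X]) [NeZero 𝔫] (𝔭 : Ideal Fq[X]) : cuspHarm R 𝔫 →ₗ[R] cuspHarm R 𝔫 where
  toFun F := ⟨heckeFun 𝔫 𝔭 F.1, heckeFun_harmonic 𝔫 𝔭 F.2.1, heckeFun_invariant 𝔫 𝔭 F.2.2.1,
    heckeFun_cuspidal (NeZero.ne 𝔫) 𝔭 F.2.2.2⟩
  map_add' F G := Subtype.ext (funext fun e => by simp [heckeFun, Finset.sum_add_distrib])
  map_smul' c F := Subtype.ext (funext fun e => by simp [heckeFun, Finset.mul_sum])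

end Stability

/-! ### Fourier coefficients -/

/-- The matrix with rows `(π ^ k, u)` and `(0, 1)`. -/
def stdMat (k : ℤ) (u : Fq⸨X⸩) : GL (Fin 2) Fq⸨X⸩ :=
  GeneralLinearGroup.mkOfDetNeZero !![HahnSeries.single k 1, u; 0, 1]
    (by simp [Matrix.det_fin_two])

/-- The edge represented by the matrix with rows `(π ^ k, u)` and `(0, 1)`. -/
def stdEdge (k : ℤ) (u : Fq⸨X⸩) : Edge Fq := QuotientGroup.mk (stdMat k u)

/-- The additive character `η(∑ aₖ πᵏ) = η₀(Tr(a₁))` of `Fq((π))`. -/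
def etaChar {p : ℕ} [Algebra (ZMod p) Fq] (η₀ : AddChar (ZMod p) ℂ) (x : Fq⸨X⸩) : ℂ :=
  η₀ (Algebra.trace (ZMod p) Fq (x.coeff 1))

/-- The element `x₀ π + x₁ π² + ⋯` of `Fq((π))`. As `x` varies, these elements represent the
classes of `π Fq[[π]]` modulo `π ^ (N + 1) Fq[[π]]`. -/
def fracRep {N : ℕ} (x : Fin N → Fq) : Fq⸨X⸩ :=
  ∑ i : Fin N, HahnSeries.single ((i : ℤ) + 1) (x i)

/-- The Fourier coefficient of `F` with respect to the ideal of `A` with monic generator `M`. -/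
def fourierCoeff [Fintype Fq] {p : ℕ} [Algebra (ZMod p) Fq] (η₀ : AddChar (ZMod p) ℂ) (M : Fq[X])
    (F : Edge Fq → ℂ) : ℂ :=
  (Fintype.card Fq : ℂ) ^ (-1 - (M.natDegree : ℤ)) *
    ∑ x : Fin (1 + M.natDegree) → Fq,
      F (stdEdge (2 + M.natDegree) (fracRep x)) * etaChar η₀ (-(polyEmb Fq M * fracRep x))

section FirstCoefficient

theorem stdEdge_add (k : ℤ) (u : Fq⸨X⸩) (v : Fq⟦X⟧) :
    stdEdge k (u + HahnSeries.single k 1 * HahnSeries.ofPowerSeries ℤ Fq v) = stdEdge k u := by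
  have hk : IsUnit (!![1, v; 0, 1] : Matrix (Fin 2) (Fin 2) Fq⟦X⟧).det := by
    simp [Matrix.det_fin_two]
  rw [stdEdge, stdEdge, ← QuotientGroup.mk_mul_of_mem (s := edgeSubgroup Fq) (stdMat k u)
    (integralGL_mem_edgeSubgroup (k := GeneralLinearGroup.mk'' _ hk) (dvd_zero _))]
  congr 1
  apply GeneralLinearGroup.ext
  intro i j
  fin_cases i <;> fin_cases j <;>
    simp [integralGL, Matrix.mul_apply, Fin.sum_univ_two, stdMat, GeneralLinearGroup.mkOfDetNeZero,
      GeneralLinearGroup.mk'', GeneralLinearGroup.mk', Matrix.unitOfDetInvertible,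
      Matrix.nonsingInvUnit, add_comm]

theorem stdEdge_translate {R : Type*} {𝔫 : Ideal Fq[X]} {F : Edge Fq → R}
    (hF : IsInvariant 𝔫 F) (k : ℤ) (u : Fq⸨X⸩) (P : Fq[X]) :
    F (stdEdge k (u + polyEmb Fq P)) = F (stdEdge k u) := by
  have hk : IsUnit (!![1, P; 0, 1] : Matrix (Fin 2) (Fin 2) Fq[X]).det := by
    simp [Matrix.det_fin_two]
  rw [← hF (polyGL Fq (GeneralLinearGroup.mk'' _ hk)) ⟨_, 𝔫.zero_mem, rfl⟩ (stdEdge k u)]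
  congr 1
  change _ = QuotientGroup.mk (s := edgeSubgroup Fq) _
  rw [stdEdge]
  congr 1
  apply GeneralLinearGroup.ext
  intro i j
  fin_cases i <;> fin_cases j <;>
    simp [polyGL, Matrix.mul_apply, Fin.sum_univ_two, stdMat, GeneralLinearGroup.mkOfDetNeZero,
      GeneralLinearGroup.mk'', GeneralLinearGroup.mk', Matrix.unitOfDetInvertible,
      Matrix.nonsingInvUnit]

theorem stdEdge_dilate {R : Type*} {𝔫 : Ideal Fq[X]} {F : Edge Fq → R}
    (hF : IsInvariant 𝔫 F) (k : ℤ) (u : Fq⸨X⸩) {a : Fq} (ha : a ≠ 0) :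
    F (stdEdge k (HahnSeries.C a * u)) = F (stdEdge k u) := by
  have hP : IsUnit (!![Polynomial.C a, 0; 0, 1] : Matrix (Fin 2) (Fin 2) Fq[X]).det := by
    simp [Matrix.det_fin_two, ha]
  have hO : IsUnit (!![PowerSeries.C a, 0; 0, 1] : Matrix (Fin 2) (Fin 2) Fq⟦X⟧).det := by
    simp [Matrix.det_fin_two, ha]
  rw [← hF (polyGL Fq (GeneralLinearGroup.mk'' _ hP)) ⟨_, 𝔫.zero_mem, rfl⟩ (stdEdge k u)]
  congr 1
  rw [stdEdge, ← QuotientGroup.mk_mul_of_mem (s := edgeSubgroup Fq) _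
    (integralGL_mem_edgeSubgroup (k := GeneralLinearGroup.mk'' _ hO) (dvd_zero _))]
  change _ = QuotientGroup.mk (s := edgeSubgroup Fq) _
  congr 1
  apply GeneralLinearGroup.ext
  intro i j
  fin_cases i <;> fin_cases j <;>
    simp [polyGL, integralGL, Matrix.mul_apply, Fin.sum_univ_two,
      stdMat, GeneralLinearGroup.mkOfDetNeZero, polyEmb, mul_comm,
      GeneralLinearGroup.mk'', GeneralLinearGroup.mk', Matrix.unitOfDetInvertible,
      Matrix.nonsingInvUnit]

/-- The matrix with rows `(x, 1)` and `(1, 0)`. -/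
def neighbourMatrix (x : Fq) : GL (Fin 2) Fq⟦X⟧ :=
  GeneralLinearGroup.mk'' !![PowerSeries.C x, 1; 1, 0] (by simp [Matrix.det_fin_two])

theorem neighbourMatrix_val (x : Fq) :
    (neighbourMatrix x).1 = !![PowerSeries.C x, 1; 1, 0] := rfl

theorem integralGL_injective : Function.Injective (integralGL Fq) := by
  intro k k' h
  apply GeneralLinearGroup.ext
  intro i j
  apply HahnSeries.ofPowerSeries_injective (Γ := ℤ)
  exact congrArg (fun x : GL (Fin 2) Fq⸨X⸩ => x i j) h

theorem integralGL_mem_iff {k : GL (Fin 2) Fq⟦X⟧} :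
    integralGL Fq k ∈ edgeSubgroup Fq ↔ PowerSeries.X ∣ k 1 0 := by
  refine ⟨fun h => ?_, integralGL_mem_edgeSubgroup⟩
  obtain ⟨z, k', ⟨c, hc⟩, h⟩ := mem_edgeSubgroup.1 h
  have e : ∀ i j, (z : Fq⸨X⸩) * HahnSeries.ofPowerSeries ℤ Fq (k' i j) =
      HahnSeries.ofPowerSeries ℤ Fq (k i j) := by
    intro i j
    have := congrArg (fun x : GL (Fin 2) Fq⸨X⸩ => x i j) h
    simpa [integralGL, GeneralLinearGroup.coe_scalar] using this
  have e0 : k 0 0 * k' 1 0 = k 1 0 * k' 0 0 := by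
    apply HahnSeries.ofPowerSeries_injective (Γ := ℤ)
    rw [map_mul, map_mul, ← e, ← e]; ring
  have hdet := (GeneralLinearGroup.det k').isUnit
  rw [GeneralLinearGroup.val_det_apply, Matrix.det_fin_two, PowerSeries.isUnit_iff_constantCoeff]
    at hdet
  rw [PowerSeries.X_dvd_iff]
  have h1 := congrArg PowerSeries.constantCoeff e0
  rw [hc] at h1 hdet
  simp only [map_mul, map_sub, PowerSeries.constantCoeff_X, zero_mul, mul_zero, sub_zero,
    IsUnit.mul_iff] at h1 hdet
  exact (mul_eq_zero.1 h1.symm).resolve_right hdet.1.ne_zero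

/-- The `q + 1` edges with the same origin as the class of `g`. -/
def star (g : GL (Fin 2) Fq⸨X⸩) : Option Fq → {e : Edge Fq // origin e = (g : Vertex Fq)}
  | none => ⟨(g : Edge Fq), rfl⟩
  | some x => ⟨((g * integralGL Fq (neighbourMatrix x) : GL (Fin 2) Fq⸨X⸩) : Edge Fq),
      QuotientGroup.mk_mul_of_mem (s := vertexSubgroup Fq) g
        (Subgroup.mem_sup_right ⟨neighbourMatrix x, rfl⟩)⟩

theorem neighbourMatrix_inv_mul (x : Fq) (k : GL (Fin 2) Fq⟦X⟧) :
    ((neighbourMatrix x)⁻¹ * k) 1 0 = k 0 0 - PowerSeries.C x * k 1 0 := by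
  set l := (neighbourMatrix x)⁻¹ * k with hl
  have h : k = neighbourMatrix x * l := by rw [hl]; group
  have h0 : k 0 0 = PowerSeries.C x * l 0 0 + l 1 0 := by
    rw [h, GeneralLinearGroup.coe_mul, neighbourMatrix_val]
    simp [Matrix.mul_apply, Fin.sum_univ_two]
  have h1 : k 1 0 = l 0 0 := by
    rw [h, GeneralLinearGroup.coe_mul, neighbourMatrix_val]
    simp [Matrix.mul_apply, Fin.sum_univ_two]
  rw [h0, h1]; ring

theorem star_bijective (g : GL (Fin 2) Fq⸨X⸩) : Function.Bijective (star g) := by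
  have hmk : ∀ k k' : GL (Fin 2) Fq⟦X⟧,
      (((g * integralGL Fq k : GL (Fin 2) Fq⸨X⸩) : Edge Fq) =
        ((g * integralGL Fq k' : GL (Fin 2) Fq⸨X⸩) : Edge Fq)) ↔
          PowerSeries.X ∣ (k⁻¹ * k') 1 0 := by
    intro k k'
    rw [QuotientGroup.eq, ← integralGL_mem_iff, map_mul, map_inv]
    have : (g * integralGL Fq k)⁻¹ * (g * integralGL Fq k') =
      (integralGL Fq k)⁻¹ * integralGL Fq k' := by group
    rw [this]
  have h1 : (g : Edge Fq) = ((g * integralGL Fq 1 : GL (Fin 2) Fq⸨X⸩) : Edge Fq) := by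
    rw [map_one, mul_one]
  have hns : ∀ x : Fq, ¬ (((g * integralGL Fq (neighbourMatrix x) : GL (Fin 2) Fq⸨X⸩) : Edge Fq)
      = (g : Edge Fq)) := by
    intro x hx
    rw [h1, hmk, neighbourMatrix_inv_mul, PowerSeries.X_dvd_iff] at hx
    simp at hx
  constructor
  · rintro (_ | x) (_ | y) h
    · rfl
    · exact absurd (congrArg Subtype.val h).symm (hns y)
    · exact absurd (congrArg Subtype.val h) (hns x)
    · have h' := (hmk _ _).1 (congrArg Subtype.val h)
      rw [neighbourMatrix_inv_mul, PowerSeries.X_dvd_iff] at h'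
      simp only [neighbourMatrix_val] at h'
      simp [sub_eq_zero] at h'
      rw [h']
  · rintro ⟨e, he⟩
    induction e using QuotientGroup.induction_on with
    | _ h =>
    have he' : ((g : GL (Fin 2) Fq⸨X⸩) : Vertex Fq) = (h : Vertex Fq) := he.symm
    rw [QuotientGroup.eq] at he'
    obtain ⟨z, k, hk⟩ := mem_vertexSubgroup.1 he'
    have h2 : h = g * integralGL Fq k * GeneralLinearGroup.scalar (Fin 2) z := by
      rw [← GeneralLinearGroup.scalar_commute, ← mul_assoc, GeneralLinearGroup.scalar_commute,
        mul_assoc, hk]; group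
    have h3 : (h : Edge Fq) = ((g * integralGL Fq k : GL (Fin 2) Fq⸨X⸩) : Edge Fq) := by
      rw [h2]
      exact QuotientGroup.mk_mul_of_mem _ (Subgroup.mem_sup_left ⟨z, rfl⟩)
    by_cases hc : PowerSeries.constantCoeff (k 1 0) = 0
    · refine ⟨none, Subtype.ext ?_⟩
      change (g : Edge Fq) = h
      rw [h3, h1, hmk, PowerSeries.X_dvd_iff]
      simpa using hc
    · refine ⟨some (PowerSeries.constantCoeff (k 0 0) / PowerSeries.constantCoeff (k 1 0)),
        Subtype.ext ?_⟩
      change ((g * integralGL Fq (neighbourMatrix _) : GL (Fin 2) Fq⸨X⸩) : Edge Fq) = h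
      rw [h3, hmk, neighbourMatrix_inv_mul, PowerSeries.X_dvd_iff]
      simp [div_mul_cancel₀ _ hc]

theorem reverse_stdEdge (k : ℤ) (u : Fq⸨X⸩) (x : Fq) :
    reverse (stdEdge (k + 1) (u + HahnSeries.single k x)) =
      ((stdMat k u * integralGL Fq (neighbourMatrix x) : GL (Fin 2) Fq⸨X⸩) : Edge Fq) := by
  have hz : unif Fq ≠ 0 := by simp [unif]
  rw [← QuotientGroup.mk_mul_of_mem (s := edgeSubgroup Fq) _
    (Subgroup.mem_sup_left ⟨Units.mk0 _ hz, rfl⟩)]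
  change QuotientGroup.mk (s := edgeSubgroup Fq) _ = _
  congr 1
  apply GeneralLinearGroup.ext
  intro i j
  fin_cases i <;> fin_cases j <;>
    simp [flipMatrix, integralGL, Matrix.mul_apply, Fin.sum_univ_two, Matrix.vecMul, dotProduct,
      stdMat, GeneralLinearGroup.mkOfDetNeZero, neighbourMatrix_val, GeneralLinearGroup.coe_scalar,
      unif, add_mul, add_comm, Matrix.diagonal_apply]

variable [Fintype Fq] {𝔫 : Ideal Fq[X]}

theorem stdEdge_sum {R : Type*} [CommRing R] {F : Edge Fq → R} (hF : IsHarmonic F) (k : ℤ)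
    (u : Fq⸨X⸩) :
    F (stdEdge k u) = ∑ x : Fq, F (stdEdge (k + 1) (u + HahnSeries.single k x)) := by
  classical
  have h := hF.2 (stdMat k u : Vertex Fq)
  rw [← finsum_comp_equiv (f := fun e : {e : Edge Fq // origin e = (stdMat k u : Vertex Fq)} => F e)
    (Equiv.ofBijective _ (star_bijective (stdMat k u))), finsum_eq_sum_of_fintype, Fintype.sum_option] at h
  have h2 : ∀ x : Fq, F (star (stdMat k u) (some x)).1 =
      - F (stdEdge (k + 1) (u + HahnSeries.single k x)) := by
    intro x
    rw [eq_neg_iff_add_eq_zero, add_comm, ← hF.1 (stdEdge (k + 1) _), reverse_stdEdge]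
    rfl
  simp only [Equiv.ofBijective_apply] at h
  rw [Finset.sum_congr rfl fun x _ => h2 x, Finset.sum_neg_distrib] at h
  exact eq_of_sub_eq_zero (by rw [sub_eq_add_neg]; exact h)

theorem stdEdge_one_eq_zero (F : cuspHarm ℤ 𝔫) : F.1 (stdEdge 1 0) = 0 := by
  obtain ⟨hh, hi, hc⟩ := F.2
  have hq : 2 ≤ Fintype.card Fq := Fintype.one_lt_card
  have hpow : ∀ m : ℕ, F.1 (stdEdge (1 - m) 0) = (Fintype.card Fq : ℤ) ^ m * F.1 (stdEdge 1 0) := by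
    intro m
    induction m with
    | zero => simp
    | succ m ih =>
      rw [stdEdge_sum hh]
      have hx : ∀ x : Fq, F.1 (stdEdge (1 - ((m + 1 : ℕ) : ℤ) + 1)
          (0 + HahnSeries.single (1 - ((m + 1 : ℕ) : ℤ)) x)) = F.1 (stdEdge (1 - m) 0) := by
        intro x
        rw [← stdEdge_translate hi _ 0 (Polynomial.monomial m x)]
        have e1 : 1 - ((m + 1 : ℕ) : ℤ) + 1 = 1 - m := by push_cast; ring
        have e2 : 1 - ((m + 1 : ℕ) : ℤ) = -m := by push_cast; ring
        have e3 : polyEmb Fq (Polynomial.monomial m x) = HahnSeries.single (-(m : ℤ)) x := by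
          simp [polyEmb, HahnSeries.C_apply]
        rw [e1, e2, e3]
      rw [Finset.sum_congr rfl fun x _ => hx x, ih]
      simp [pow_succ]; ring
  obtain ⟨t, ht, htF⟩ := isCuspidal_iff.1 hc
  have hfin : (Set.range F.1).Finite := by
    refine ((ht.image F.1).union (Set.finite_singleton 0)).subset ?_
    rintro _ ⟨e, rfl⟩
    by_cases h0 : F.1 e = 0
    · exact Or.inr h0
    · obtain ⟨γ, hγ, e', he', rfl⟩ := htF e h0
      exact Or.inl ⟨e', he', (hi _ ⟨γ, hγ, rfl⟩ e').symm⟩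
  by_contra h0
  have hinj : Function.Injective fun m : ℕ => F.1 (stdEdge (1 - m) 0) := by
    intro m m' h
    simp only [hpow] at h
    have h1 := mul_right_cancel₀ h0 h
    exact Nat.pow_right_injective hq (by exact_mod_cast h1)
  exact (Set.infinite_range_of_injective hinj)
    (hfin.subset (by rintro _ ⟨m, rfl⟩; exact ⟨_, rfl⟩))

theorem stdEdge_two_zero (F : cuspHarm ℤ 𝔫) :
    F.1 (stdEdge 2 0) = -((Fintype.card Fq : ℤ) - 1) * F.1 (stdEdge 2 (unif Fq)) := by
  classical
  have h := stdEdge_sum F.2.1 1 0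
  rw [stdEdge_one_eq_zero, ← Finset.add_sum_erase _ _ (Finset.mem_univ 0)] at h
  have hx : ∀ x ∈ Finset.univ.erase (0 : Fq), F.1 (stdEdge (1 + 1) (0 + HahnSeries.single 1 x)) =
      F.1 (stdEdge 2 (unif Fq)) := by
    intro x hx
    rw [← stdEdge_dilate F.2.2.1 2 (unif Fq) (Finset.ne_of_mem_erase hx)]
    simp [unif]
  rw [Finset.sum_congr rfl hx, Finset.sum_const, Finset.card_erase_of_mem (Finset.mem_univ _),
    Finset.card_univ, nsmul_eq_mul, Nat.cast_sub Fintype.card_pos] at h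
  simp only [map_zero, add_zero, Nat.cast_one] at h
  have e2 : (1 + 1 : ℤ) = 2 := rfl
  rw [e2] at h
  linear_combination -h

/-- For an integral cuspidal harmonic cochain, the Fourier coefficient with respect to the trivial
ideal is an integer. -/
theorem fourierCoeff_one {p : ℕ} [Fact p.Prime] [Algebra (ZMod p) Fq] (η₀ : AddChar (ZMod p) ℂ)
    (hη₀ : η₀ ≠ 1) (F : cuspHarm ℤ 𝔫) :
    fourierCoeff η₀ 1 (fun e => (F.1 e : ℂ)) = ((-F.1 (stdEdge 2 (unif Fq)) : ℤ) : ℂ) := by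
  classical
  rw [fourierCoeff]
  have hN : (1 : Fq[X]).natDegree = 0 := Polynomial.natDegree_one
  generalize (1 : Fq[X]).natDegree = N at hN ⊢
  subst hN
  have hsum : ∀ f : Fq → ℂ, ∑ x : Fin (1 + 0) → Fq, f (x 0) = ∑ a : Fq, f a := fun f =>
    (Equiv.funUnique (Fin 1) Fq).sum_comp f
  have hrep : ∀ x : Fin (1 + 0) → Fq, fracRep x = HahnSeries.single 1 (x 0) := by
    intro x
    rw [fracRep]
    refine (Fin.sum_univ_one _).trans ?_
    simp
  let ψ : AddChar Fq ℂ := η₀.compAddMonoidHom (-(Algebra.trace (ZMod p) Fq).toAddMonoidHom)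
  have hψ : ψ ≠ 1 := by
    intro h
    apply hη₀
    ext a
    obtain ⟨b, hb⟩ := Algebra.trace_surjective (ZMod p) Fq (-a)
    have := DFunLike.congr_fun h b
    simpa [ψ, hb] using this
  have hterm : ∀ x : Fin (1 + 0) → Fq,
      (F.1 (stdEdge (2 + ((0 : ℕ) : ℤ)) (fracRep x)) : ℂ) *
        etaChar η₀ (-(polyEmb Fq 1 * fracRep x)) =
      (fun a : Fq => (F.1 (stdEdge 2 (HahnSeries.single 1 a)) : ℂ) * ψ a) (x 0) := by
    intro x
    simp [hrep, etaChar, ψ]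
  rw [Finset.sum_congr rfl fun x _ => hterm x,
    hsum (fun a : Fq => (F.1 (stdEdge 2 (HahnSeries.single 1 a)) : ℂ) * ψ a),
    ← Finset.add_sum_erase _ _ (Finset.mem_univ 0)]
  have hx : ∀ x ∈ Finset.univ.erase (0 : Fq), (F.1 (stdEdge 2 (HahnSeries.single 1 x)) : ℂ) * ψ x =
      F.1 (stdEdge 2 (unif Fq)) * ψ x := by
    intro x hx
    rw [← stdEdge_dilate F.2.2.1 2 (unif Fq) (Finset.ne_of_mem_erase hx)]
    simp [unif]
  have hs := AddChar.sum_eq_zero_of_ne_one hψ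
  rw [← Finset.add_sum_erase _ _ (Finset.mem_univ 0), AddChar.map_zero_eq_one] at hs
  rw [Finset.sum_congr rfl hx, ← Finset.mul_sum, AddChar.map_zero_eq_one, map_zero,
    stdEdge_two_zero]
  have hq : (Fintype.card Fq : ℂ) ≠ 0 := by exact_mod_cast Fintype.card_ne_zero
  have hs' : ∑ x ∈ Finset.univ.erase (0 : Fq), ψ x = -1 := by linear_combination hs
  rw [hs']
  push_cast
  simp only [_root_.zpow_neg_one]
  field_simp
  ring

end FirstCoefficient

/-! ### The Hecke algebra and the pairings -/

section Pairings

/-- The Hecke algebra `𝕋(𝔫, ℤ)`: the subalgebra of `End(H₀(𝔫, ℤ))` generated by the Hecke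
operators. (For the zero ideal the sum which defines `hecke` is empty, so this generator is `0`.) -/
def heckeAlgebra [Finite Fq] (𝔫 : Ideal Fq[X]) [NeZero 𝔫] :
    Subalgebra ℤ (Module.End ℤ (cuspHarm ℤ 𝔫)) :=
  Algebra.adjoin ℤ (Set.range (hecke ℤ 𝔫))

/-- The Hecke operator `T_𝔭` as an element of `𝕋(𝔫, ℤ)`. -/
def heckeElt [Finite Fq] (𝔫 : Ideal Fq[X]) [NeZero 𝔫] (𝔭 : Ideal Fq[X]) : heckeAlgebra 𝔫 :=
  ⟨hecke ℤ 𝔫 𝔭, Algebra.subset_adjoin ⟨𝔭, rfl⟩⟩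

/-- The Hecke algebra modulo `p`, `𝕋(𝔫, 𝔽_p) = 𝔽_p ⊗ 𝕋(𝔫, ℤ)`. -/
abbrev HeckeAlgebraMod [Finite Fq] (p : ℕ) (𝔫 : Ideal Fq[X]) [NeZero 𝔫] : Type _ :=
  ZMod p ⊗[ℤ] heckeAlgebra 𝔫

/-- The Hecke operator `T_𝔭` as an element of `𝕋(𝔫, 𝔽_p)`. -/
def heckeEltMod [Finite Fq] (p : ℕ) (𝔫 : Ideal Fq[X]) [NeZero 𝔫] (𝔭 : Ideal Fq[X]) :
    HeckeAlgebraMod p 𝔫 :=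
  1 ⊗ₜ[ℤ] heckeElt 𝔫 𝔭

theorem exists_int_fourierCoeff [Fintype Fq] {𝔫 : Ideal Fq[X]} {p : ℕ} [Fact p.Prime]
    [Algebra (ZMod p) Fq] {η₀ : AddChar (ZMod p) ℂ} (hη₀ : η₀ ≠ 1) (F : cuspHarm ℤ 𝔫) :
    ∃ c : ℤ, (c : ℂ) = fourierCoeff η₀ 1 (fun e => (F.1 e : ℂ)) :=
  ⟨_, (fourierCoeff_one η₀ hη₀ F).symm⟩

theorem choose_fourierCoeff [Fintype Fq] {𝔫 : Ideal Fq[X]} {p : ℕ} [Fact p.Prime]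
    [Algebra (ZMod p) Fq] {η₀ : AddChar (ZMod p) ℂ} (hη₀ : η₀ ≠ 1) (F : cuspHarm ℤ 𝔫) :
    (exists_int_fourierCoeff hη₀ F).choose = -F.1 (stdEdge 2 (unif Fq)) := by
  have h := (exists_int_fourierCoeff hη₀ F).choose_spec
  have h' := h.trans (fourierCoeff_one η₀ hη₀ F)
  exact_mod_cast h'

/-- The Fourier coefficient `c₁(F)` of `F ∈ H₀(𝔫, ℤ)` with respect to the trivial ideal, as an
integer. -/
def firstCoeff [Fintype Fq] (𝔫 : Ideal Fq[X]) {p : ℕ} [Fact p.Prime] [Algebra (ZMod p) Fq]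
    {η₀ : AddChar (ZMod p) ℂ} (hη₀ : η₀ ≠ 1) : cuspHarm ℤ 𝔫 →ₗ[ℤ] ℤ where
  toFun F := (exists_int_fourierCoeff hη₀ F).choose
  map_add' F G := by
    rw [choose_fourierCoeff hη₀, choose_fourierCoeff hη₀, choose_fourierCoeff hη₀, Submodule.coe_add, Pi.add_apply]
    ring
  map_smul' c F := by
    rw [choose_fourierCoeff hη₀, choose_fourierCoeff hη₀, Submodule.coe_smul, Pi.smul_apply]
    simp

theorem firstCoeff_spec [Fintype Fq] (𝔫 : Ideal Fq[X]) {p : ℕ} [Fact p.Prime]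
    [Algebra (ZMod p) Fq] {η₀ : AddChar (ZMod p) ℂ} (hη₀ : η₀ ≠ 1) (F : cuspHarm ℤ 𝔫) :
    (firstCoeff 𝔫 hη₀ F : ℂ) = fourierCoeff η₀ 1 (fun e => (F.1 e : ℂ)) :=
  (exists_int_fourierCoeff hη₀ F).choose_spec

theorem firstCoeff_apply [Fintype Fq] (𝔫 : Ideal Fq[X]) {p : ℕ} [Fact p.Prime]
    [Algebra (ZMod p) Fq] {η₀ : AddChar (ZMod p) ℂ} (hη₀ : η₀ ≠ 1) (F : cuspHarm ℤ 𝔫) :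
    firstCoeff 𝔫 hη₀ F = -F.1 (stdEdge 2 (unif Fq)) :=
  choose_fourierCoeff hη₀ F

/-- The reduction map `H₀(𝔫, ℤ) → H₀(𝔫, R)`. -/
def cuspHarmCast [Finite Fq] (R : Type*) [CommRing R] (𝔫 : Ideal Fq[X]) :
    cuspHarm ℤ 𝔫 →ₗ[ℤ] cuspHarm R 𝔫 where
  toFun F := ⟨fun e => (F.1 e : R), by
    obtain ⟨⟨h1, h2⟩, h3, h4⟩ := F.2
    refine ⟨⟨fun e => by rw [← Int.cast_add, h1, Int.cast_zero], fun v => ?_⟩,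
      fun γ hγ e => congrArg _ (h3 γ hγ e), h4.subset (Set.image_mono fun e he h => he (by simp [h]))⟩
    have : Fintype {e : Edge Fq // origin e = v} := Fintype.ofFinite _
    have h5 := h2 v
    rw [finsum_eq_sum_of_fintype] at h5 ⊢
    rw [← Int.cast_sum, h5, Int.cast_zero]⟩
  map_add' F G := Subtype.ext (funext fun e => by simp)
  map_smul' c F := Subtype.ext (funext fun e => by simp)

/-- The canonical map `R ⊗ H₀(𝔫, ℤ) → H₀(𝔫, R)`. -/
def baseChangeMap [Finite Fq] (R : Type*) [CommRing R] (𝔫 : Ideal Fq[X]) :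
    R ⊗[ℤ] cuspHarm ℤ 𝔫 →ₗ[R] cuspHarm R 𝔫 :=
  LinearMap.liftBaseChange R (cuspHarmCast R 𝔫)

/-- The module `H₀₀(𝔫, R)`: the image of `R ⊗ H₀(𝔫, ℤ)` in `H₀(𝔫, R)`. -/
def cuspHarm₀₀ [Finite Fq] (R : Type*) [CommRing R] (𝔫 : Ideal Fq[X]) :
    Submodule R (cuspHarm R 𝔫) :=
  LinearMap.range (baseChangeMap R 𝔫)

theorem baseChangeMap_one_tmul [Finite Fq] {R : Type*} [CommRing R] {𝔫 : Ideal Fq[X]}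
    (F : cuspHarm ℤ 𝔫) : baseChangeMap R 𝔫 (1 ⊗ₜ[ℤ] F) = cuspHarmCast R 𝔫 F := by
  rw [baseChangeMap, LinearMap.liftBaseChange_tmul, one_smul]

/-- The reduction `F mod p` of `F ∈ H₀(𝔫, ℤ)`, as an element of `H₀₀(𝔫, 𝔽_p)`. -/
def reduceMod [Finite Fq] (p : ℕ) {𝔫 : Ideal Fq[X]} (F : cuspHarm ℤ 𝔫) :
    cuspHarm₀₀ (ZMod p) 𝔫 :=
  ⟨cuspHarmCast (ZMod p) 𝔫 F, 1 ⊗ₜ[ℤ] F, baseChangeMap_one_tmul F⟩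

theorem exists_eq_tmul {M : Type*} [AddCommGroup M] (p : ℕ) (x : ZMod p ⊗[ℤ] M) :
    ∃ m : M, x = 1 ⊗ₜ[ℤ] m := by
  induction x using TensorProduct.induction_on with
  | zero => exact ⟨0, by simp⟩
  | tmul a m =>
    obtain ⟨k, rfl⟩ := ZMod.intCast_surjective a
    refine ⟨k • m, ?_⟩
    rw [TensorProduct.tmul_smul, TensorProduct.smul_tmul', zsmul_one]
  | add x y hx hy =>
    obtain ⟨m, rfl⟩ := hx
    obtain ⟨m', rfl⟩ := hy
    exact ⟨m + m', by rw [TensorProduct.tmul_add]⟩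

/-- A cuspidal harmonic cochain with values in `pℤ` is `p` times a cuspidal harmonic cochain. -/
theorem baseChangeMap_injective [Finite Fq] (p : ℕ) [Fact p.Prime] (𝔫 : Ideal Fq[X]) :
    Function.Injective (baseChangeMap (ZMod p) 𝔫) := by
  rw [← LinearMap.ker_eq_bot, LinearMap.ker_eq_bot']
  intro x hx
  obtain ⟨F, rfl⟩ := exists_eq_tmul p x
  have hp : (p : ℤ) ≠ 0 := by exact_mod_cast (Fact.out : p.Prime).ne_zero
  have h0 : ∀ e, (F.1 e : ZMod p) = 0 := by
    intro e
    have h1 := congrArg (fun G : cuspHarm (ZMod p) 𝔫 => G.1 e) hx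
    simpa [baseChangeMap, cuspHarmCast] using h1
  have h1 : ∀ e, ∃ c : ℤ, F.1 e = p * c := fun e => by
    obtain ⟨c, hc⟩ := (ZMod.intCast_zmod_eq_zero_iff_dvd _ _).1 (h0 e)
    exact ⟨c, hc⟩
  choose G hG using h1
  obtain ⟨⟨k1, k2⟩, k3, k4⟩ := F.2
  have hGm : G ∈ cuspHarm ℤ 𝔫 := by
    refine ⟨⟨fun e => ?_, fun v => ?_⟩, fun γ hγ e => ?_, k4.subset (Set.image_mono ?_)⟩
    · apply mul_left_cancel₀ hp
      rw [mul_add, ← hG, ← hG, k1, mul_zero]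
    · have : Fintype {e : Edge Fq // origin e = v} := Fintype.ofFinite _
      have h5 := k2 v
      rw [finsum_eq_sum_of_fintype] at h5 ⊢
      apply mul_left_cancel₀ hp
      rw [Finset.mul_sum, mul_zero, ← h5]
      exact Finset.sum_congr rfl fun e _ => (hG _).symm
    · apply mul_left_cancel₀ hp
      rw [← hG, ← hG, k3 γ hγ]
    · intro e he h
      exact he (mul_left_cancel₀ hp (by rw [← hG, h, mul_zero]))
  have hF : F = (p : ℤ) • (⟨G, hGm⟩ : cuspHarm ℤ 𝔫) :=
    Subtype.ext (funext fun e => by simpa using hG e)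
  rw [hF, TensorProduct.tmul_smul, TensorProduct.smul_tmul']
  simp

/-- The canonical isomorphism `𝔽_p ⊗ H₀(𝔫, ℤ) ≃ H₀₀(𝔫, 𝔽_p)`. -/
def cuspHarm₀₀Equiv [Finite Fq] (p : ℕ) [Fact p.Prime] (𝔫 : Ideal Fq[X]) :
    ZMod p ⊗[ℤ] cuspHarm ℤ 𝔫 ≃ₗ[ZMod p] cuspHarm₀₀ (ZMod p) 𝔫 :=
  LinearEquiv.ofInjective _ (baseChangeMap_injective p 𝔫)

theorem cuspHarm₀₀Equiv_one_tmul [Finite Fq] (p : ℕ) [Fact p.Prime] {𝔫 : Ideal Fq[X]}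
    (F : cuspHarm ℤ 𝔫) : cuspHarm₀₀Equiv p 𝔫 (1 ⊗ₜ[ℤ] F) = reduceMod p F :=
  Subtype.ext (baseChangeMap_one_tmul F)

theorem reduceMod_surjective [Finite Fq] (p : ℕ) [Fact p.Prime] (𝔫 : Ideal Fq[X]) :
    Function.Surjective (reduceMod p (𝔫 := 𝔫)) := by
  intro G
  obtain ⟨x, rfl⟩ := (cuspHarm₀₀Equiv p 𝔫).surjective G
  obtain ⟨F, rfl⟩ := exists_eq_tmul p x
  exact ⟨F, (cuspHarm₀₀Equiv_one_tmul p F).symm⟩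

variable [Fintype Fq] (𝔫 : Ideal Fq[X]) [NeZero 𝔫] {p : ℕ} [Fact p.Prime] [Algebra (ZMod p) Fq]
  {η₀ : AddChar (ZMod p) ℂ} (hη₀ : η₀ ≠ 1)

/-- The pairing `(θ, F) ↦ c₁(θ F)` between `𝕋(𝔫, ℤ)` and `H₀(𝔫, ℤ)`. -/
def pairingInt : heckeAlgebra 𝔫 →ₗ[ℤ] cuspHarm ℤ 𝔫 →ₗ[ℤ] ℤ :=
  LinearMap.mk₂ ℤ (fun θ F => firstCoeff 𝔫 hη₀ (θ.1 F))
    (fun θ θ' F => by simp) (fun c θ F => by simp) (fun θ F G => by simp) (fun c θ F => by simp)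

/-- The pairing `pairingInt` after extension of scalars from `ℤ` to `𝔽_p`. -/
def pairingTensor : HeckeAlgebraMod p 𝔫 →ₗ[ZMod p] ZMod p ⊗[ℤ] cuspHarm ℤ 𝔫 →ₗ[ZMod p] ZMod p :=
  LinearMap.liftBaseChange (ZMod p)
    (((LinearMap.liftBaseChangeEquiv (ZMod p)).toLinearMap.restrictScalars ℤ) ∘ₗ
      (LinearMap.compRight ℤ (Int.castAddHom (ZMod p)).toIntLinearMap) ∘ₗ pairingInt 𝔫 hη₀)

/-- The pairing between `𝕋(𝔫, 𝔽_p)` and `H₀₀(𝔫, 𝔽_p)`, which is the reduction of `pairingInt`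
modulo `p`. -/
def pairingMod : HeckeAlgebraMod p 𝔫 →ₗ[ZMod p] cuspHarm₀₀ (ZMod p) 𝔫 →ₗ[ZMod p] ZMod p :=
  (pairingTensor 𝔫 hη₀).compl₂ (cuspHarm₀₀Equiv p 𝔫).symm.toLinearMap

/-- The defining property of the pairing: `(θ mod p, F mod p) ↦ c₁(θ F) mod p`. -/
theorem pairingMod_apply (θ : heckeAlgebra 𝔫) (F : cuspHarm ℤ 𝔫) :
    pairingMod 𝔫 hη₀ (1 ⊗ₜ[ℤ] θ) (reduceMod p F) =
      ((firstCoeff 𝔫 hη₀ (θ.1 F) : ℤ) : ZMod p) := by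
  have h : (cuspHarm₀₀Equiv p 𝔫).symm (reduceMod p F) = 1 ⊗ₜ[ℤ] F :=
    (LinearEquiv.symm_apply_eq _).2 (cuspHarm₀₀Equiv_one_tmul p F).symm
  change pairingTensor 𝔫 hη₀ (1 ⊗ₜ[ℤ] θ) ((cuspHarm₀₀Equiv p 𝔫).symm (reduceMod p F)) = _
  rw [h]
  simp [pairingTensor, pairingInt]

/-- The left kernel of the pairing modulo `p`. -/
def leftKernelMod : Submodule (ZMod p) (HeckeAlgebraMod p 𝔫) :=
  LinearMap.ker (pairingMod 𝔫 hη₀)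

end Pairings

/-! ### Degrees of ideals -/

/-- The degree of a non-zero ideal of `A`, which is the degree of any generator. -/
def idealDegree (𝔭 : Ideal Fq[X]) : ℕ := (Submodule.IsPrincipal.generator 𝔭).natDegree

theorem finite_ideals [Finite Fq] (d : ℕ) :
    {𝔭 : Ideal Fq[X] | 𝔭 ≠ ⊥ ∧ idealDegree 𝔭 ≤ d}.Finite := by
  refine ((finite_degree_le (Fq := Fq) d).image fun P => Ideal.span {P}).subset ?_
  rintro 𝔭 ⟨-, h⟩
  exact ⟨_, h, Ideal.span_singleton_generator 𝔭⟩

variable (Fq) in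
/-- The non-zero ideals of `A` of degree at most `d`. -/
def idealsDegreeLE [Finite Fq] (d : ℕ) : Finset (Ideal Fq[X]) :=
  (finite_ideals d).toFinset

variable (Fq) in
/-- The non-zero ideals of `A` of degree `d`. -/
def idealsDegreeEq [Finite Fq] (d : ℕ) : Finset (Ideal Fq[X]) :=
  (idealsDegreeLE Fq d).filter fun 𝔭 => idealDegree 𝔭 = d

end

end FunctionFieldHarmonic

open FunctionFieldHarmonic

namespace FunctionFieldHarmonic

variable {Fq : Type*} [Field Fq]

/-! ### Edges of the tree up to congruence -/

/-! For an integral cochain `F`, `c₁(F)` is minus the value of `F` at the edge `stdEdge 2 π`, so the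
pairing with `T_𝔭` is minus the sum of the values of `F` at the translates of this edge by matrices
with rows `(a, b)`, `(0, δ)`. Such a matrix sends it to level `2 + deg δ - deg a` and to the point
`(aπ + b)/δ` (`matGL_smul_stdEdge`).

Let `j = deg δ`. As `b` varies, the fractions `b/δ` run once through the classes of `πO` modulo
`π^(j+1)` (`fracCoeffs_injective`). Harmonicity makes the value on an edge the sum over its `q`
refinements, and integrality with cuspidality kills all levels `≤ 1`. If `a ≠ 1`, the level is at
most `j + 1`, so the sum over `b` collapses to zero (`sum_stdEdge_add_div_eq_zero`).

There remains `a = 1`, at level `j + 2`. Write `x` for the first `j` digits of `(π + b)/δ`; they are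
arbitrary. If `c` denotes the lower coefficients of `δ`, the next digit is `1 - ∑ cᵢ xᵢ`
(`stdEdge_unif_add_div`). Now sum over all monic `δ` of degree `j ≥ 1`. For `x ≠ 0` this digit is
equidistributed, each value occurring `q^(j-1)` times, and harmonicity lowers the level by one. For
`x = 0` it is always `1`. Since the sum over all `x` at level `j + 1` vanishes, the result is `q^j
F(stdEdge (j+2) π^(j+1)) - q^(j-1) F(stdEdge (j+1) 0)` (`sum_stdEdge_unif_add_div`).

For `j ≥ 2` both coefficients are divisible by `p`, which gives the second claim. Modulo `p` the
degree `1` term is `-F(stdEdge 2 0) = (q-1) F(stdEdge 2 π)`, which cancels the degree `0` term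
`F(stdEdge 2 π)`. This gives the first claim. -/

theorem exists_ofPowerSeries_of_coeff_eq_zero {k : ℤ} {z : Fq⸨X⸩} (h : ∀ i < k, z.coeff i = 0) :
    ∃ v : Fq⟦X⟧, z = HahnSeries.single k 1 * HahnSeries.ofPowerSeries ℤ Fq v := by
  rcases eq_or_ne z 0 with rfl | hz
  · exact ⟨0, by simp⟩
  have hk : k ≤ z.order := by
    by_contra hlt
    exact hz (HahnSeries.coeff_order_eq_zero.1 (h _ (not_le.1 hlt)))
  obtain ⟨n, hn⟩ := Int.eq_ofNat_of_zero_le (sub_nonneg.2 hk)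
  refine ⟨PowerSeries.X ^ n * z.powerSeriesPart, ?_⟩
  conv_lhs => rw [← LaurentSeries.single_order_mul_powerSeriesPart z]
  rw [map_mul, HahnSeries.ofPowerSeries_X_pow, ← mul_assoc, HahnSeries.single_mul_single, one_mul]
  rw [show k + (n : ℤ) = z.order by omega]

/-- Right multiplication by a unipotent upper triangular Iwahori matrix changes `u` by an arbitrary
element of `π^k O`, so only the digits of `u` below `π^k` matter. -/
theorem stdEdge_congr {k : ℤ} {u v : Fq⸨X⸩} (h : ∀ i < k, u.coeff i = v.coeff i) :
    stdEdge k u = stdEdge k v := by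
  obtain ⟨w, hw⟩ := exists_ofPowerSeries_of_coeff_eq_zero (k := k) (z := u - v)
    (fun i hi => by rw [HahnSeries.coeff_sub, h i hi, sub_self])
  rw [← sub_add_cancel u v, hw, add_comm, stdEdge_add]

/-- The edge represented by the matrix with rows `(z, u)` and `(0, 1)` depends on `z` only through
its order. -/
theorem mk_upperTriangular_eq_stdEdge {z u : Fq⸨X⸩} (hz : z ≠ 0)
    (h : (!![z, u; 0, 1] : Matrix (Fin 2) (Fin 2) Fq⸨X⸩).det ≠ 0) :
    (QuotientGroup.mk (Matrix.GeneralLinearGroup.mkOfDetNeZero !![z, u; 0, 1] h) : Edge Fq) =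
      stdEdge z.order u := by
  -- The unit part of `z` is absorbed by a diagonal Iwahori matrix; its constant term is the leading
  -- coefficient of `z`.
  have hO : IsUnit (!![z.powerSeriesPart, 0; 0, 1] : Matrix (Fin 2) (Fin 2) Fq⟦X⟧).det := by
    rw [Matrix.det_fin_two_of, mul_one, mul_zero, sub_zero, PowerSeries.isUnit_iff_constantCoeff,
      ← PowerSeries.coeff_zero_eq_constantCoeff_apply, LaurentSeries.powerSeriesPart_coeff]
    simpa using hz
  rw [stdEdge, ← QuotientGroup.mk_mul_of_mem (s := edgeSubgroup Fq) (stdMat z.order u)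
    (integralGL_mem_edgeSubgroup (k := Matrix.GeneralLinearGroup.mk'' _ hO) (dvd_zero _))]
  congr 1
  have hz' := LaurentSeries.single_order_mul_powerSeriesPart z
  apply Matrix.GeneralLinearGroup.ext
  intro i j
  fin_cases i <;> fin_cases j <;>
    simp [integralGL, Matrix.mul_apply, Fin.sum_univ_two, stdMat,
      Matrix.GeneralLinearGroup.mkOfDetNeZero, Matrix.GeneralLinearGroup.mk'',
      Matrix.GeneralLinearGroup.mk', Matrix.unitOfDetInvertible, Matrix.nonsingInvUnit,
      hz']

/-! ### Orders and coefficients of polynomials and of fractions in `Fq((π))` -/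

theorem polyEmb_eq_sum (P : Fq[X]) :
    polyEmb Fq P = ∑ i ∈ P.support, HahnSeries.single (-(i : ℤ)) (P.coeff i) := by
  conv_lhs => rw [P.as_sum_support]
  rw [map_sum]
  refine Finset.sum_congr rfl fun i _ => ?_
  simp [polyEmb, HahnSeries.C_apply]

theorem polyEmb_coeff_of_lt (P : Fq[X]) {i : ℤ} (hi : i < -P.natDegree) :
    (polyEmb Fq P).coeff i = 0 := by
  obtain ⟨n, rfl⟩ : ∃ n : ℕ, i = -(n : ℤ) := ⟨(-i).toNat, by omega⟩
  rw [polyEmb_coeff]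
  exact Polynomial.coeff_eq_zero_of_natDegree_lt (by omega)

theorem polyEmb_coeff_of_pos (P : Fq[X]) {i : ℤ} (hi : 0 < i) : (polyEmb Fq P).coeff i = 0 := by
  rw [polyEmb_eq_sum, HahnSeries.coeff_sum]
  exact Finset.sum_eq_zero fun n _ => HahnSeries.coeff_single_of_ne (by omega)

theorem polyEmb_ne_zero {P : Fq[X]} (hP : P ≠ 0) : polyEmb Fq P ≠ 0 :=
  (map_ne_zero_iff _ polyEmb_injective).2 hP

theorem polyEmb_order {P : Fq[X]} (hP : P ≠ 0) : (polyEmb Fq P).order = -P.natDegree := by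
  apply le_antisymm
  · apply HahnSeries.order_le_of_coeff_ne_zero
    rw [polyEmb_coeff]
    simpa using hP
  · by_contra h
    exact polyEmb_ne_zero hP (HahnSeries.coeff_order_eq_zero.1 (polyEmb_coeff_of_lt P (not_le.1 h)))

theorem order_div_polyEmb {P : Fq[X]} (hP : P ≠ 0) {z : Fq⸨X⸩} (hz : z ≠ 0) :
    (z / polyEmb Fq P).order = z.order + P.natDegree := by
  have h := HahnSeries.order_mul (div_ne_zero hz (polyEmb_ne_zero hP)) (polyEmb_ne_zero hP)
  rw [div_mul_cancel₀ _ (polyEmb_ne_zero hP), polyEmb_order hP] at h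
  omega

/-- Division by `P` raises the order by `deg P`. The form with coefficients also covers the zero
series, whose `order` is the default value `0`. -/
theorem coeff_div_polyEmb_eq_zero {P : Fq[X]} (hP : P ≠ 0) {m : ℤ} {z : Fq⸨X⸩}
    (h : ∀ i < m, z.coeff i = 0) {i : ℤ} (hi : i < m + P.natDegree) :
    (z / polyEmb Fq P).coeff i = 0 := by
  rcases eq_or_ne z 0 with rfl | hz
  · simp
  apply HahnSeries.coeff_eq_zero_of_lt_order
  rw [order_div_polyEmb hP hz]
  by_contra hlt
  exact hz (HahnSeries.coeff_order_eq_zero.1 (h z.order (by omega)))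

/-- The action of an upper triangular matrix on a standard edge. -/
theorem matGL_smul_stdEdge {s : Matrix (Fin 2) (Fin 2) Fq[X]} (hs : s.det ≠ 0) (h10 : s 1 0 = 0)
    (k : ℤ) (u : Fq⸨X⸩) :
    matGL s hs • stdEdge k u = stdEdge (k + (s 1 1).natDegree - (s 0 0).natDegree)
      ((polyEmb Fq (s 0 0) * u + polyEmb Fq (s 0 1)) / polyEmb Fq (s 1 1)) := by
  have hs' := hs
  rw [Matrix.det_fin_two, h10, mul_zero, sub_zero, mul_ne_zero_iff] at hs'
  obtain ⟨h0, h1⟩ := hs'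
  have hk : (HahnSeries.single k (1 : Fq)) ≠ 0 := by simp
  have hz0 := mul_ne_zero (polyEmb_ne_zero h0) hk
  have hz := div_ne_zero hz0 (polyEmb_ne_zero h1)
  have horder : (polyEmb Fq (s 0 0) * HahnSeries.single k 1 / polyEmb Fq (s 1 1)).order =
      k + (s 1 1).natDegree - (s 0 0).natDegree := by
    rw [order_div_polyEmb h1 hz0, HahnSeries.order_mul (polyEmb_ne_zero h0) hk, polyEmb_order h0,
      HahnSeries.order_single one_ne_zero]
    ring
  have hdet : (!![polyEmb Fq (s 0 0) * HahnSeries.single k 1 / polyEmb Fq (s 1 1),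
      (polyEmb Fq (s 0 0) * u + polyEmb Fq (s 0 1)) / polyEmb Fq (s 1 1); 0, 1] :
      Matrix (Fin 2) (Fin 2) Fq⸨X⸩).det ≠ 0 := by
    rw [Matrix.det_fin_two_of]; simpa using hz
  rw [← horder, ← mk_upperTriangular_eq_stdEdge hz hdet]
  -- Multiplying the target representative by the scalar `s 1 1` clears the denominators, and
  -- scalars do not change the edge.
  rw [← QuotientGroup.mk_mul_of_mem (s := edgeSubgroup Fq) _
    (Subgroup.mem_sup_left ⟨Units.mk0 _ (polyEmb_ne_zero h1), rfl⟩)]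
  change (QuotientGroup.mk (matGL s hs * stdMat k u) : Edge Fq) = _
  congr 1
  have hp := polyEmb_ne_zero h1
  apply Matrix.GeneralLinearGroup.ext
  intro i j
  fin_cases i <;> fin_cases j <;>
    simp [matGL, Matrix.mul_apply, Fin.sum_univ_two, stdMat,
      Matrix.GeneralLinearGroup.mkOfDetNeZero, Matrix.GeneralLinearGroup.mk',
      Matrix.unitOfDetInvertible, h10,
      Matrix.GeneralLinearGroup.coe_scalar, div_mul_cancel₀ _ hp]

/-! ### Polynomials with given coefficients -/

/-- The polynomial of degree less than `j` with coefficients `c`. -/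
noncomputable def tuplePoly {j : ℕ} (c : Fin j → Fq) : Fq[X] :=
  ∑ i : Fin j, Polynomial.monomial (i : ℕ) (c i)

theorem tuplePoly_coeff {j : ℕ} (c : Fin j → Fq) (i : Fin j) : (tuplePoly c).coeff i = c i := by
  classical
  simp [tuplePoly, Polynomial.coeff_monomial, Fin.val_inj]

theorem tuplePoly_degree_lt {j : ℕ} (c : Fin j → Fq) : (tuplePoly c).degree < j := by
  refine (Polynomial.degree_lt_iff_coeff_zero _ _).2 fun m hm => ?_
  rw [tuplePoly, Polynomial.finsetSum_coeff]
  refine Finset.sum_eq_zero fun i _ => Polynomial.coeff_monomial_of_ne _ ?_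
  have := i.2
  omega

theorem tuplePoly_injective {j : ℕ} : Function.Injective (tuplePoly (Fq := Fq) (j := j)) := by
  intro c c' h
  ext i
  rw [← tuplePoly_coeff c, h, tuplePoly_coeff]

theorem exists_tuplePoly {j : ℕ} {P : Fq[X]} (hP : P.degree < j) :
    ∃ c : Fin j → Fq, tuplePoly c = P := by
  refine ⟨fun i => P.coeff i, ?_⟩
  ext m
  by_cases hm : m < j
  · exact tuplePoly_coeff _ ⟨m, hm⟩
  · rw [(Polynomial.degree_lt_iff_coeff_zero _ _).1 hP m (not_lt.1 hm),
      (Polynomial.degree_lt_iff_coeff_zero _ _).1 (tuplePoly_degree_lt _) m (not_lt.1 hm)]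

theorem polyEmb_tuplePoly {j : ℕ} (c : Fin j → Fq) :
    polyEmb Fq (tuplePoly c) = ∑ i : Fin j, HahnSeries.single (-(i : ℤ)) (c i) := by
  rw [tuplePoly, map_sum]
  refine Finset.sum_congr rfl fun i _ => ?_
  simp [polyEmb, HahnSeries.C_apply]

/-- The monic polynomial of degree `j` with lower coefficients `c`. -/
noncomputable def monicTuplePoly {j : ℕ} (c : Fin j → Fq) : Fq[X] := Polynomial.X ^ j + tuplePoly c

theorem monicTuplePoly_monic {j : ℕ} (c : Fin j → Fq) : (monicTuplePoly c).Monic :=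
  Polynomial.monic_X_pow_add (tuplePoly_degree_lt c)

theorem monicTuplePoly_natDegree {j : ℕ} (c : Fin j → Fq) : (monicTuplePoly c).natDegree = j := by
  apply Polynomial.natDegree_eq_of_degree_eq_some
  rw [monicTuplePoly, Polynomial.degree_add_eq_left_of_degree_lt, Polynomial.degree_X_pow]
  rw [Polynomial.degree_X_pow]
  exact tuplePoly_degree_lt c

theorem monicTuplePoly_injective {j : ℕ} :
    Function.Injective (monicTuplePoly (Fq := Fq) (j := j)) := fun _ _ h =>
  tuplePoly_injective (add_left_cancel h)

theorem exists_monicTuplePoly {P : Fq[X]} (hP : P.Monic) :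
    ∃ c : Fin P.natDegree → Fq, monicTuplePoly c = P := by
  have h : (P - Polynomial.X ^ P.natDegree).degree < (P.natDegree : WithBot ℕ) := by
    have := Polynomial.degree_sub_lt_left (p := P) (q := Polynomial.X ^ P.natDegree)
      (by rw [Polynomial.degree_X_pow, Polynomial.degree_eq_natDegree hP.ne_zero]) hP.ne_zero
      (by simp [hP.leadingCoeff])
    rwa [Polynomial.degree_eq_natDegree hP.ne_zero] at this
  obtain ⟨c, hc⟩ := exists_tuplePoly h
  exact ⟨c, by rw [monicTuplePoly, hc, add_sub_cancel]⟩

/-- Since `T = 1/π`, multiplication by `T^i` shifts the expansion by `i` places, so multiplication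
by a monic polynomial acts on digits like a linear recurrence. At exponents `≤ 0` it recovers the
numerator of a fraction; at exponent `1` it yields the digit of `π^(j+1)`. -/
theorem coeff_monicTuplePoly_mul {j : ℕ} (c : Fin j → Fq) (u : Fq⸨X⸩) (n : ℤ) :
    (polyEmb Fq (monicTuplePoly c) * u).coeff n =
      u.coeff (n + j) + ∑ i : Fin j, c i * u.coeff (n + i) := by
  have hX : polyEmb Fq (Polynomial.X ^ j) = HahnSeries.single (-(j : ℤ)) 1 := by
    simp [polyEmb]
  rw [monicTuplePoly, map_add, hX, polyEmb_tuplePoly, add_mul, HahnSeries.coeff_add,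
    HahnSeries.coeff_single_mul, Finset.sum_mul, HahnSeries.coeff_sum]
  simp [HahnSeries.coeff_single_mul]

theorem fracRep_coeff {N : ℕ} (x : Fin N → Fq) (i : Fin N) :
    (fracRep x).coeff ((i : ℤ) + 1) = x i := by
  classical
  simp [fracRep, HahnSeries.coeff_single, Fin.val_inj]

theorem fracRep_coeff_eq_zero {N : ℕ} (x : Fin N → Fq) {n : ℤ} (hn : n ≤ 0 ∨ N < n) :
    (fracRep x).coeff n = 0 := by
  rw [fracRep, HahnSeries.coeff_sum]
  refine Finset.sum_eq_zero fun i _ => HahnSeries.coeff_single_of_ne ?_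
  have := i.2
  omega

end FunctionFieldHarmonic

namespace FunctionFieldHarmonic

variable {Fq : Type*} [Field Fq]

/-! ### Sums over fractions with a fixed denominator -/

theorem coeff_tuplePoly_div_eq_zero {j : ℕ} (c y : Fin j → Fq) {n : ℤ} (hn : n ≤ 0) :
    (polyEmb Fq (tuplePoly y) / polyEmb Fq (monicTuplePoly c)).coeff n = 0 := by
  -- A numerator of degree less than `j` has order at least `1 - j`, and the denominator contributes
  -- `j`.
  refine coeff_div_polyEmb_eq_zero (monicTuplePoly_monic c).ne_zero (m := 1 - j) (fun i hi => ?_)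
    (by rw [monicTuplePoly_natDegree]; omega)
  rw [polyEmb_tuplePoly, HahnSeries.coeff_sum]
  refine Finset.sum_eq_zero fun l _ => HahnSeries.coeff_single_of_ne ?_
  have := l.2
  omega

/-- The coefficients of `π, …, π ^ j` in the expansion of a fraction with denominator of
degree `j`. -/
noncomputable def fracCoeffs {j : ℕ} (c y : Fin j → Fq) : Fin j → Fq := fun i =>
  (polyEmb Fq (tuplePoly y) / polyEmb Fq (monicTuplePoly c)).coeff ((i : ℤ) + 1)

/-- If `b/δ` and `b'/δ` agree up to `π^j`, their difference has order greater than `j`. Multiplied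
by `δ` it then has positive order, yet it is the polynomial `b - b'`, hence zero. Over a finite
field this makes `fracCoeffs c` a bijection. -/
theorem fracCoeffs_injective {j : ℕ} (c : Fin j → Fq) : Function.Injective (fracCoeffs c) := by
  intro y y' h
  have hδ := polyEmb_ne_zero (monicTuplePoly_monic c).ne_zero
  set u := polyEmb Fq (tuplePoly y) / polyEmb Fq (monicTuplePoly c) -
    polyEmb Fq (tuplePoly y') / polyEmb Fq (monicTuplePoly c) with hu
  have h0 : ∀ n : ℤ, n ≤ j → u.coeff n = 0 := by
    intro n hn
    rw [hu, HahnSeries.coeff_sub]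
    rcases le_or_gt n 0 with h' | h'
    · rw [coeff_tuplePoly_div_eq_zero c y h', coeff_tuplePoly_div_eq_zero c y' h', sub_zero]
    · obtain ⟨m, rfl⟩ : ∃ m : ℕ, n = (m : ℤ) + 1 := ⟨(n - 1).toNat, by omega⟩
      exact sub_eq_zero.2 (congrFun h ⟨m, by omega⟩)
  have h1 : polyEmb Fq (monicTuplePoly c) * u =
      polyEmb Fq (tuplePoly y) - polyEmb Fq (tuplePoly y') := by
    rw [hu, mul_sub, mul_div_cancel₀ _ hδ, mul_div_cancel₀ _ hδ]
  ext i
  have h2 := congrArg (fun z : Fq⸨X⸩ => z.coeff (-(i : ℤ))) h1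
  simp only [coeff_monicTuplePoly_mul, HahnSeries.coeff_sub, polyEmb_coeff, tuplePoly_coeff] at h2
  rw [h0 _ (by omega), Finset.sum_eq_zero fun l _ => ?_, zero_add] at h2
  · exact sub_eq_zero.1 h2.symm
  · have := l.2
    rw [h0 _ (by omega), mul_zero]

/-- The expansion of `(π + b) / δ` up to order `deg δ + 1`. -/
theorem stdEdge_unif_add_div {j : ℕ} (c y : Fin j → Fq) :
    stdEdge ((j : ℤ) + 2)
      ((unif Fq + polyEmb Fq (tuplePoly y)) / polyEmb Fq (monicTuplePoly c)) =
    stdEdge ((j : ℤ) + 2) (fracRep (fracCoeffs c y) +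
      HahnSeries.single ((j : ℤ) + 1) (1 - ∑ i : Fin j, c i * fracCoeffs c y i)) := by
  have hδ := polyEmb_ne_zero (monicTuplePoly_monic c).ne_zero
  set u := (unif Fq + polyEmb Fq (tuplePoly y)) / polyEmb Fq (monicTuplePoly c) with hu
  -- The term `π/δ` has order `j + 1`, so it leaves the digits up to `π^j` unchanged.
  have h0 : ∀ n : ℤ, n ≤ j → u.coeff n =
      (polyEmb Fq (tuplePoly y) / polyEmb Fq (monicTuplePoly c)).coeff n := by
    intro n hn
    rw [hu, add_div, HahnSeries.coeff_add, coeff_div_polyEmb_eq_zero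
      (monicTuplePoly_monic c).ne_zero (m := 1), zero_add]
    · exact fun i hi => HahnSeries.coeff_single_of_ne hi.ne
    · rw [monicTuplePoly_natDegree]; omega
  have h1 : ∀ i : Fin j, u.coeff ((i : ℤ) + 1) = fracCoeffs c y i := fun i =>
    h0 _ (by have := i.2; omega)
  -- Compare the coefficients of `π` in `δ u = π + b`: the polynomial `b` has none, and `δ u`
  -- contributes the top digit plus `∑ cᵢ` times the digit of `π^(i+1)`.
  have h2 : u.coeff ((j : ℤ) + 1) = 1 - ∑ i : Fin j, c i * fracCoeffs c y i := by
    have h3 := coeff_monicTuplePoly_mul c u 1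
    rw [hu, mul_div_cancel₀ _ hδ, ← hu, HahnSeries.coeff_add,
      polyEmb_coeff_of_pos _ one_pos, unif, HahnSeries.coeff_single_same, add_zero] at h3
    simp only [add_comm (1 : ℤ), h1] at h3
    exact eq_sub_of_add_eq h3.symm
  refine stdEdge_congr fun n hn => ?_
  rw [HahnSeries.coeff_add]
  rcases le_or_gt n 0 with h' | h'
  · rw [h0 _ (by omega), coeff_tuplePoly_div_eq_zero c y h', fracRep_coeff_eq_zero _ (Or.inl h'),
      HahnSeries.coeff_single_of_ne (by omega), add_zero]
  · obtain ⟨m, rfl⟩ : ∃ m : ℕ, n = (m : ℤ) + 1 := ⟨(n - 1).toNat, by omega⟩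
    by_cases hm : m < j
    · rw [HahnSeries.coeff_single_of_ne (by omega), add_zero]
      exact (h1 ⟨m, hm⟩).trans (fracRep_coeff _ ⟨m, hm⟩).symm
    · obtain rfl : m = j := by omega
      rw [h2, fracRep_coeff_eq_zero _ (Or.inr (by omega)), HahnSeries.coeff_single_same, zero_add]

variable [Fintype Fq]

theorem sum_fracCoeffs {M : Type*} [AddCommMonoid M] {j : ℕ} (c : Fin j → Fq)
    (f : (Fin j → Fq) → M) : ∑ y, f (fracCoeffs c y) = ∑ x, f x :=
  (Equiv.ofBijective _ (Finite.injective_iff_bijective.1 (fracCoeffs_injective c))).sum_comp f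

/-- This is `stdEdge_sum` iterated `N` times, starting from level `1`. -/
theorem sum_stdEdge_fracRep {R : Type*} [CommRing R] {F : Edge Fq → R} (hF : IsHarmonic F)
    (N : ℕ) (v : Fq⸨X⸩) :
    ∑ x : Fin N → Fq, F (stdEdge (N + 1) (v + fracRep x)) = F (stdEdge 1 v) := by
  induction N with
  | zero => simp [fracRep]
  | succ N ih =>
    -- The last digit is the finest refinement; summing over it first drops the level by one.
    rw [← ih, ← (Fin.snocEquiv fun _ => Fq).sum_comp, Fintype.sum_prod_type_right]
    refine Finset.sum_congr rfl fun x _ => ?_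
    rw [stdEdge_sum hF]
    refine Finset.sum_congr rfl fun a _ => ?_
    change F (stdEdge _ (v + fracRep (Fin.snoc (α := fun _ => Fq) x a))) = _
    rw [fracRep, Fin.sum_univ_castSucc]
    simp [fracRep, add_assoc]

/-! ### Vanishing from cuspidality, and averages over numerators and denominators -/

variable {𝔫 : Ideal Fq[X]}

/-- At level `1` only the digits of `u` at exponents `≤ 0` matter. They form a polynomial in `T`,
which a translation in `Γ₀(𝔫)` removes, leaving `stdEdge 1 0`. Lower levels are sums of values at
level `1` by harmonicity. -/
theorem stdEdge_eq_zero_of_le_one (F : cuspHarm ℤ 𝔫) {k : ℤ} (hk : k ≤ 1) (u : Fq⸨X⸩) :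
    F.1 (stdEdge k u) = 0 := by
  obtain ⟨n, rfl⟩ : ∃ n : ℕ, k = 1 - n := ⟨(1 - k).toNat, by omega⟩
  clear hk
  induction n generalizing u with
  | zero =>
    -- `M` bounds the pole order of `u`. When `u` has no pole, `toNat` gives `0` and the polynomial
    -- is the constant term.
    set M := (-u.order).toNat
    let c : Fin (M + 1) → Fq := fun i => u.coeff (-(i : ℤ))
    have h : stdEdge (1 - (0 : ℕ)) u = stdEdge 1 (0 + polyEmb Fq (tuplePoly c)) := by
      refine stdEdge_congr fun i hi => ?_
      obtain ⟨m, rfl⟩ : ∃ m : ℕ, i = -(m : ℤ) := ⟨(-i).toNat, by simp at hi; omega⟩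
      rw [zero_add, polyEmb_coeff]
      by_cases hm : m < M + 1
      · exact (tuplePoly_coeff c ⟨m, hm⟩).symm
      · rw [(Polynomial.degree_lt_iff_coeff_zero _ _).1 (tuplePoly_degree_lt c) m (not_lt.1 hm)]
        exact HahnSeries.coeff_eq_zero_of_lt_order (by omega)
    rw [h, stdEdge_translate F.2.2.1, stdEdge_one_eq_zero]
  | succ n ih =>
    rw [stdEdge_sum F.2.1]
    refine Finset.sum_eq_zero fun x _ => ?_
    rw [show (1 - ((n + 1 : ℕ) : ℤ) + 1) = 1 - n by push_cast; ring]
    exact ih _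

/-- At level `j + 1` the fractions represent every class of `πO` once, so the sum telescopes to the
value at `stdEdge 1 v`, which is zero. A lower level is refined one step at a time; the shift `v` is
arbitrary so that it can take up the new digits. -/
theorem sum_stdEdge_add_div_eq_zero (F : cuspHarm ℤ 𝔫) {j : ℕ} (c : Fin j → Fq) {k : ℤ}
    (hk : k ≤ j + 1) (v : Fq⸨X⸩) :
    ∑ y : Fin j → Fq, F.1 (stdEdge k
      (v + polyEmb Fq (tuplePoly y) / polyEmb Fq (monicTuplePoly c))) = 0 := by
  obtain ⟨n, rfl⟩ : ∃ n : ℕ, k = j + 1 - n := ⟨(j + 1 - k).toNat, by omega⟩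
  clear hk
  induction n generalizing v with
  | zero =>
    have h : ∀ y : Fin j → Fq, stdEdge ((j : ℤ) + 1 - (0 : ℕ))
        (v + polyEmb Fq (tuplePoly y) / polyEmb Fq (monicTuplePoly c)) =
          stdEdge (j + 1) (v + fracRep (fracCoeffs c y)) := by
      intro y
      rw [Nat.cast_zero, sub_zero]
      refine stdEdge_congr fun i hi => ?_
      rw [HahnSeries.coeff_add, HahnSeries.coeff_add]
      congr 1
      rcases le_or_gt i 0 with h' | h'
      · rw [coeff_tuplePoly_div_eq_zero c y h', fracRep_coeff_eq_zero _ (Or.inl h')]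
      · obtain ⟨m, rfl⟩ : ∃ m : ℕ, i = (m : ℤ) + 1 := ⟨(i - 1).toNat, by omega⟩
        exact (fracRep_coeff (fracCoeffs c y) ⟨m, by omega⟩).symm
    simp only [h]
    rw [sum_fracCoeffs c fun x => F.1 (stdEdge (j + 1) (v + fracRep x)),
      sum_stdEdge_fracRep F.2.1, stdEdge_eq_zero_of_le_one F le_rfl]
  | succ n ih =>
    rw [Finset.sum_congr rfl fun y _ => stdEdge_sum F.2.1 _ _, Finset.sum_comm]
    refine Finset.sum_eq_zero fun x _ => ?_
    -- The new digit is moved into the shift, so that the induction hypothesis applies to `v` plus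
    -- that digit.
    simp only [add_right_comm v _ (HahnSeries.single _ x)]
    rw [show ((j : ℤ) + 1 - ((n + 1 : ℕ) : ℤ) + 1) = j + 1 - n by push_cast; ring]
    exact ih _

/-- A nonzero linear form on `Fq^(m+1)` takes each value `q^m` times. -/
theorem sum_sub_linearForm {M : Type*} [AddCommMonoid M] {m : ℕ} {x : Fin (m + 1) → Fq}
    (hx : x ≠ 0) (a : Fq) (f : Fq → M) :
    ∑ c : Fin (m + 1) → Fq, f (a - ∑ i, c i * x i) = Fintype.card Fq ^ m • ∑ y, f y := by
  obtain ⟨l, hl⟩ := Function.ne_iff.1 hx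
  rw [← (Fin.insertNthEquiv (fun _ => Fq) l).sum_comp, Fintype.sum_prod_type_right]
  have h : ∀ c : Fin m → Fq, ∑ z : Fq, f (a - ∑ i, Fin.insertNthEquiv (fun _ => Fq) l (z, c) i * x i)
      = ∑ y, f y := by
    intro c
    -- With the other coordinates fixed, the coordinate at `l` enters through multiplication by `x l
    -- ≠ 0` and a subtraction, a bijection of `Fq`.
    rw [← ((Equiv.mulRight₀ (x l) hl).trans
      (Equiv.subLeft (a - ∑ i, c i * x (l.succAbove i)))).sum_comp f]
    refine Finset.sum_congr rfl fun z _ => ?_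
    rw [Fin.sum_univ_succAbove _ l]
    simp [sub_sub, add_comm]
  simp only [h]
  rw [Finset.sum_const, Finset.card_univ, Fintype.card_pi, Finset.prod_const, Finset.card_univ,
    Fintype.card_fin]

/-- Averaging over the denominators decouples the top digit from the lower ones, except when all
lower digits vanish. The degree is written `m + 1` because equidistribution of the top digit
requires at least one free coefficient. -/
theorem sum_stdEdge_unif_add_div (F : cuspHarm ℤ 𝔫) (m : ℕ) :
    ∑ c : Fin (m + 1) → Fq, ∑ y : Fin (m + 1) → Fq, F.1 (stdEdge (((m + 1 : ℕ) : ℤ) + 2)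
      ((unif Fq + polyEmb Fq (tuplePoly y)) / polyEmb Fq (monicTuplePoly c))) =
    (Fintype.card Fq : ℤ) ^ (m + 1) *
        F.1 (stdEdge (((m + 1 : ℕ) : ℤ) + 2) (HahnSeries.single (((m + 1 : ℕ) : ℤ) + 1) 1)) -
      (Fintype.card Fq : ℤ) ^ m * F.1 (stdEdge (((m + 1 : ℕ) : ℤ) + 1) 0) := by
  classical
  have h : ∀ c : Fin (m + 1) → Fq, ∑ y : Fin (m + 1) → Fq, F.1 (stdEdge (((m + 1 : ℕ) : ℤ) + 2)
      ((unif Fq + polyEmb Fq (tuplePoly y)) / polyEmb Fq (monicTuplePoly c))) =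
      ∑ x : Fin (m + 1) → Fq, F.1 (stdEdge (((m + 1 : ℕ) : ℤ) + 2)
        (fracRep x + HahnSeries.single (((m + 1 : ℕ) : ℤ) + 1) (1 - ∑ i, c i * x i))) := by
    intro c
    simp only [stdEdge_unif_add_div]
    exact sum_fracCoeffs c fun x => F.1 (stdEdge (((m + 1 : ℕ) : ℤ) + 2)
      (fracRep x + HahnSeries.single (((m + 1 : ℕ) : ℤ) + 1) (1 - ∑ i, c i * x i)))
  -- For `x ≠ 0` the top digit runs over `Fq` with multiplicity `q^m`, and one harmonic step absorbs
  -- the sum over it.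
  have hne : ∀ x ∈ Finset.univ.erase (0 : Fin (m + 1) → Fq),
      ∑ c : Fin (m + 1) → Fq, F.1 (stdEdge (((m + 1 : ℕ) : ℤ) + 2)
        (fracRep x + HahnSeries.single (((m + 1 : ℕ) : ℤ) + 1) (1 - ∑ i, c i * x i))) =
      (Fintype.card Fq : ℤ) ^ m * F.1 (stdEdge (((m + 1 : ℕ) : ℤ) + 1) (0 + fracRep x)) := by
    intro x hx
    rw [sum_sub_linearForm (Finset.ne_of_mem_erase hx) 1 fun a =>
      F.1 (stdEdge (((m + 1 : ℕ) : ℤ) + 2)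
        (fracRep x + HahnSeries.single (((m + 1 : ℕ) : ℤ) + 1) a)), stdEdge_sum F.2.1, nsmul_eq_mul,
      Nat.cast_pow, add_assoc _ (1 : ℤ) 1, zero_add, one_add_one_eq_two]
  have h0 : fracRep (0 : Fin (m + 1) → Fq) = 0 := by simp [fracRep]
  -- The sum over all `x` at level `m + 2` is the value at `stdEdge 1 0`, which is zero; hence the
  -- nonzero `x` contribute minus the value at `x = 0`.
  have hall := sum_stdEdge_fracRep F.2.1 (m + 1) 0
  rw [stdEdge_eq_zero_of_le_one F le_rfl, ← Finset.add_sum_erase _ _ (Finset.mem_univ 0), h0,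
    add_zero] at hall
  simp only [h]
  rw [Finset.sum_comm, ← Finset.add_sum_erase _ _ (Finset.mem_univ 0), Finset.sum_congr rfl hne,
    ← Finset.mul_sum, eq_neg_of_add_eq_zero_right hall, h0]
  simp
  ring

end FunctionFieldHarmonic

namespace FunctionFieldHarmonic

variable {Fq : Type*} [Field Fq]

/-! ### Hecke operators at the standard edge -/

theorem idealDegree_span {P : Fq[X]} : idealDegree (Ideal.span {P}) = P.natDegree :=
  Polynomial.natDegree_eq_of_degree_eq (Polynomial.degree_eq_degree_of_associated
    (Submodule.IsPrincipal.associated_generator_span_self P))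

theorem diagonal_mul_eq {𝔫 : Ideal Fq[X]} {δ : Fq[X]} (hδ : δ.Monic)
    {s : Matrix (Fin 2) (Fin 2) Fq[X]} (hs : s ∈ heckeSet 𝔫 (Ideal.span {δ})) :
    s 0 0 * s 1 1 = δ :=
  Polynomial.eq_of_monic_of_associated (hs.2.1.mul hs.2.2.1) hδ
    (Ideal.span_singleton_eq_span_singleton.1 hs.2.2.2.1)

/-- The elements of `heckeSet` with the same diagonal as a given one. -/
noncomputable def heckeSetEquiv {𝔫 : Ideal Fq[X]} {δ : Fq[X]} (hδ : δ.Monic)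
    (s₀ : heckeSet 𝔫 (Ideal.span {δ})) {j : ℕ} (c : Fin j → Fq) (hc : monicTuplePoly c = s₀.1 1 1) :
    (Fin j → Fq) ≃ {s : heckeSet 𝔫 (Ideal.span {δ}) // s.1 0 0 = s₀.1 0 0} :=
  Equiv.ofBijective
    (fun y => ⟨⟨!![s₀.1 0 0, tuplePoly y; 0, s₀.1 1 1], rfl, s₀.2.2.1, s₀.2.2.2.1, s₀.2.2.2.2.1,
      s₀.2.2.2.2.2.1, by
        change (tuplePoly y).degree < (s₀.1 1 1).degree
        rw [← hc, Polynomial.degree_eq_natDegree (monicTuplePoly_monic c).ne_zero,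
          monicTuplePoly_natDegree]
        exact tuplePoly_degree_lt y⟩, rfl⟩) (by
    constructor
    · intro y y' h
      have h1 := congrArg (fun s => s.1.1 0 1) h
      exact tuplePoly_injective h1
    · rintro ⟨s, h⟩
      have h11 : s.1 1 1 = s₀.1 1 1 := by
        -- The product of the diagonal entries is `δ`, so the upper left entry determines the lower
        -- right one.
        have := (diagonal_mul_eq hδ s.2).trans (diagonal_mul_eq hδ s₀.2).symm
        rw [h] at this
        exact mul_left_cancel₀ s₀.2.2.1.ne_zero this
      have h01 := s.2.2.2.2.2.2
      rw [h11, ← hc, Polynomial.degree_eq_natDegree (monicTuplePoly_monic c).ne_zero,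
          monicTuplePoly_natDegree] at h01
      obtain ⟨y, hy⟩ := exists_tuplePoly h01
      refine ⟨y, Subtype.ext (Subtype.ext ?_)⟩
      ext1 i l
      fin_cases i <;> fin_cases l
      exacts [h.symm, hy, s.2.1.symm, h11.symm])

variable [Fintype Fq] {𝔫 : Ideal Fq[X]}

/-- The condition of being prime to `𝔫` concerns only the upper left entry. Once the diagonal is
fixed, the upper right entry therefore runs over all polynomials of smaller degree, whatever the
level. -/
theorem sum_heckeSet_fiber [DecidableEq Fq[X]] (F : cuspHarm ℤ 𝔫) {δ : Fq[X]} (hδ : δ.Monic)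
    (s₀ : heckeSet 𝔫 (Ideal.span {δ})) {j : ℕ} (c : Fin j → Fq) (hc : monicTuplePoly c = s₀.1 1 1) :
    ∑ s : heckeSet 𝔫 (Ideal.span {δ}) with s.1 0 0 = s₀.1 0 0, F.1 (heckeGL s • stdEdge 2 (unif Fq)) =
      ∑ y : Fin j → Fq, F.1 (stdEdge (2 + j - (s₀.1 0 0).natDegree)
        ((polyEmb Fq (s₀.1 0 0) * unif Fq + polyEmb Fq (tuplePoly y)) /
          polyEmb Fq (monicTuplePoly c))) := by
  rw [Finset.sum_subtype (p := fun s => s.1 0 0 = s₀.1 0 0) _ (by simp),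
    ← (heckeSetEquiv hδ s₀ c hc).sum_comp]
  refine Finset.sum_congr rfl fun y _ => ?_
  rw [heckeGL, matGL_smul_stdEdge _ (heckeSetEquiv hδ s₀ c hc y).1.2.1]
  change F.1 (stdEdge (2 + (s₀.1 1 1).natDegree - (s₀.1 0 0).natDegree)
    ((polyEmb Fq (s₀.1 0 0) * unif Fq + polyEmb Fq (tuplePoly y)) / polyEmb Fq (s₀.1 1 1))) = _
  rw [← hc, monicTuplePoly_natDegree]

/-- Only the matrices with upper left entry `1` contribute to the value of a Hecke operator at the
edge which computes the first Fourier coefficient. -/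
theorem heckeFun_stdEdge_two (F : cuspHarm ℤ 𝔫) {j : ℕ} (c : Fin j → Fq) :
    heckeFun 𝔫 (Ideal.span {monicTuplePoly c}) F.1 (stdEdge 2 (unif Fq)) =
      ∑ y : Fin j → Fq, F.1 (stdEdge (j + 2)
        ((unif Fq + polyEmb Fq (tuplePoly y)) / polyEmb Fq (monicTuplePoly c))) := by
  classical
  have hδ := monicTuplePoly_monic c
  let s₁ : heckeSet 𝔫 (Ideal.span {monicTuplePoly c}) :=
    ⟨!![1, 0; 0, monicTuplePoly c], rfl, Polynomial.monic_one, hδ,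
      by change Ideal.span {1 * monicTuplePoly c} = _; rw [one_mul],
      by change Ideal.span {1} ⊔ 𝔫 = ⊤; rw [Ideal.span_singleton_one, top_sup_eq],
      by
        change (0 : Fq[X]).degree < (monicTuplePoly c).degree
        rw [Polynomial.degree_zero, bot_lt_iff_ne_bot]
        exact Polynomial.degree_ne_bot.2 hδ.ne_zero⟩
  have h1 := sum_heckeSet_fiber F hδ s₁ c rfl
  have hfib : ∀ a : Fq[X], a ≠ 1 →
      ∑ s : heckeSet 𝔫 (Ideal.span {monicTuplePoly c}) with s.1 0 0 = a,
        F.1 (heckeGL s • stdEdge 2 (unif Fq)) = 0 := by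
    intro a ha
    by_cases hex : ∃ s₀ : heckeSet 𝔫 (Ideal.span {monicTuplePoly c}), s₀.1 0 0 = a
    · obtain ⟨s₀, rfl⟩ := hex
      obtain ⟨c', hc'⟩ := exists_monicTuplePoly s₀.2.2.2.1
      rw [sum_heckeSet_fiber F hδ s₀ c' hc']
      -- The part `aπ/d` does not depend on `b` and plays the role of the shift `v`.
      simp only [add_div]
      refine sum_stdEdge_add_div_eq_zero F c' ?_ _
      -- A monic `a ≠ 1` has degree at least `1`, which is exactly what brings the level `2 + deg d
      -- - deg a` down to `deg d + 1`.
      have := (Polynomial.Monic.natDegree_pos s₀.2.2.1).2 ha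
      omega
    · rw [Finset.filter_false_of_mem fun s _ h => hex ⟨s, h⟩, Finset.sum_empty]
  rw [heckeFun, ← Finset.sum_filter_add_sum_filter_not _ fun s => s.1 0 0 = 1]
  have h2 : ∑ s : heckeSet 𝔫 (Ideal.span {monicTuplePoly c}) with ¬ s.1 0 0 = 1,
      F.1 (heckeGL s • stdEdge 2 (unif Fq)) = 0 := by
    rw [← Finset.sum_fiberwise_of_maps_to
      (fun s hs => Finset.mem_image_of_mem (fun s : heckeSet 𝔫 _ => s.1 0 0) hs)]
    refine Finset.sum_eq_zero fun a ha => ?_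
    obtain ⟨s, hs, rfl⟩ := Finset.mem_image.1 ha
    have hs1 := (Finset.mem_filter.1 hs).2
    -- Since the chosen diagonal entry is not `1`, restricting its fibre to matrices with entry
    -- different from `1` removes nothing.
    rw [Finset.filter_filter, ← hfib _ hs1]
    congr 1
    ext s'
    simp only [Finset.mem_filter_univ]
    exact ⟨And.right, fun h => ⟨by rwa [h], h⟩⟩
  rw [h2, add_zero]
  refine Eq.trans h1 (Finset.sum_congr rfl fun y _ => ?_)
  change F.1 (stdEdge (2 + j - (1 : Fq[X]).natDegree)
    ((polyEmb Fq 1 * unif Fq + polyEmb Fq (tuplePoly y)) / polyEmb Fq (monicTuplePoly c))) = _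
  rw [Polynomial.natDegree_one, map_one, one_mul, Nat.cast_zero, sub_zero, add_comm (2 : ℤ)]

/-! ### Ideals of given degree and their monic generators -/

theorem mem_idealsDegreeLE {d : ℕ} {𝔭 : Ideal Fq[X]} :
    𝔭 ∈ idealsDegreeLE Fq d ↔ 𝔭 ≠ ⊥ ∧ idealDegree 𝔭 ≤ d :=
  (finite_ideals d).mem_toFinset

theorem mem_idealsDegreeEq {d : ℕ} {𝔭 : Ideal Fq[X]} :
    𝔭 ∈ idealsDegreeEq Fq d ↔ 𝔭 ≠ ⊥ ∧ idealDegree 𝔭 = d := by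
  rw [idealsDegreeEq, Finset.mem_filter, mem_idealsDegreeLE]
  exact ⟨fun h => ⟨h.1.1, h.2⟩, fun h => ⟨⟨h.1, h.2.le⟩, h.2⟩⟩

theorem sum_idealsDegreeEq {M : Type*} [AddCommMonoid M] (j : ℕ) (f : Ideal Fq[X] → M) :
    ∑ 𝔭 ∈ idealsDegreeEq Fq j, f 𝔭 = ∑ c : Fin j → Fq, f (Ideal.span {monicTuplePoly c}) := by
  refine (Finset.sum_bij (fun c _ => Ideal.span {monicTuplePoly c}) ?_ ?_ ?_ ?_).symm
  · intro c _
    rw [mem_idealsDegreeEq, idealDegree_span, monicTuplePoly_natDegree]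
    exact ⟨fun h => (monicTuplePoly_monic c).ne_zero (Ideal.span_singleton_eq_bot.1 h), rfl⟩
  · intro c _ c' _ h
    exact monicTuplePoly_injective (Polynomial.eq_of_monic_of_associated (monicTuplePoly_monic c)
      (monicTuplePoly_monic c') (Ideal.span_singleton_eq_span_singleton.1 h))
  · intro 𝔭 h𝔭
    obtain ⟨h0, hj⟩ := mem_idealsDegreeEq.1 h𝔭
    set g := Submodule.IsPrincipal.generator 𝔭
    have hg : g ≠ 0 := fun h => h0 ((Submodule.IsPrincipal.eq_bot_iff_generator_eq_zero 𝔭).2 h)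
    have hm := Polynomial.monic_mul_leadingCoeff_inv hg
    have hspan : Ideal.span {g * Polynomial.C g.leadingCoeff⁻¹} = 𝔭 := by
      rw [Ideal.span_singleton_mul_right_unit, Ideal.span_singleton_generator]
      exact Polynomial.isUnit_C.2 (by simpa using hg)
    have hdeg : (g * Polynomial.C g.leadingCoeff⁻¹).natDegree = j := by
      rw [← hj, ← idealDegree_span, hspan]
    obtain ⟨c, hc⟩ := exists_monicTuplePoly hm
    -- The tuple of lower coefficients is indexed by the degree of the generator, so `j` is replaced
    -- by that degree.
    subst hdeg
    exact ⟨c, Finset.mem_univ _, by rw [hc, hspan]⟩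
  · exact fun _ _ => rfl

theorem sum_idealsDegreeLE {M : Type*} [AddCommMonoid M] (d : ℕ) (f : Ideal Fq[X] → M) :
    ∑ 𝔭 ∈ idealsDegreeLE Fq d, f 𝔭 =
      ∑ j ∈ Finset.range (d + 1), ∑ 𝔭 ∈ idealsDegreeEq Fq j, f 𝔭 := by
  rw [← Finset.sum_fiberwise_of_maps_to (t := Finset.range (d + 1)) (g := idealDegree)
    fun 𝔭 h𝔭 => Finset.mem_range_succ_iff.2 (mem_idealsDegreeLE.1 h𝔭).2]
  refine Finset.sum_congr rfl fun j hj => Finset.sum_congr ?_ fun _ _ => rfl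
  ext 𝔭
  rw [Finset.mem_filter, mem_idealsDegreeLE, mem_idealsDegreeEq]
  have := Finset.mem_range_succ_iff.1 hj
  exact ⟨fun h => ⟨h.1.1, h.2⟩, fun h => ⟨⟨h.1, h.2.trans_le this⟩, h.2⟩⟩

/-! ### The left kernel modulo `p` -/

section LeftKernel

variable [NeZero 𝔫] {p : ℕ} [Fact p.Prime] [Algebra (ZMod p) Fq] {η₀ : AddChar (ZMod p) ℂ}
  (hη₀ : η₀ ≠ 1)

/-- The pairing becomes, up to sign, an evaluation at one edge, because `c₁` does. -/
theorem pairingMod_heckeEltMod (𝔭 : Ideal Fq[X]) (F : cuspHarm ℤ 𝔫) :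
    pairingMod 𝔫 hη₀ (heckeEltMod p 𝔫 𝔭) (reduceMod p F) =
      ((-heckeFun 𝔫 𝔭 F.1 (stdEdge 2 (unif Fq)) : ℤ) : ZMod p) := by
  rw [heckeEltMod, pairingMod_apply, firstCoeff_apply]
  rfl

theorem pairingMod_sum_degreeEq (j : ℕ) (F : cuspHarm ℤ 𝔫) :
    pairingMod 𝔫 hη₀ (∑ 𝔭 ∈ idealsDegreeEq Fq j, heckeEltMod p 𝔫 𝔭) (reduceMod p F) =
      ((-∑ c : Fin j → Fq, ∑ y : Fin j → Fq, F.1 (stdEdge (j + 2)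
        ((unif Fq + polyEmb Fq (tuplePoly y)) / polyEmb Fq (monicTuplePoly c))) : ℤ) : ZMod p) := by
  rw [sum_idealsDegreeEq, map_sum, LinearMap.sum_apply]
  simp only [pairingMod_heckeEltMod, heckeFun_stdEdge_two]
  rw [← Int.cast_sum, Finset.sum_neg_distrib]

variable (Fq p) in
theorem natCast_card_eq_zero : (Fintype.card Fq : ZMod p) = 0 := by
  have : CharP Fq p := charP_of_injective_algebraMap (algebraMap (ZMod p) Fq).injective p
  rw [ZMod.natCast_eq_zero_iff, ← CharP.cast_eq_zero_iff Fq p, Nat.cast_card_eq_zero]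

theorem sum_degreeEq_mem_leftKernelMod {d : ℕ} (hd : 2 ≤ d) :
    (∑ 𝔭 ∈ idealsDegreeEq Fq d, heckeEltMod p 𝔫 𝔭) ∈ leftKernelMod 𝔫 hη₀ := by
  refine LinearMap.mem_ker.2 (LinearMap.ext fun G => ?_)
  -- Elements of `H₀₀` lift to integral cochains, for which the vanishing at low levels is
  -- available.
  obtain ⟨F, rfl⟩ := reduceMod_surjective p 𝔫 G
  -- In degree `m + 2` the smaller power of `q` is `q^(m+1)`, still zero modulo `p`.
  obtain ⟨m, rfl⟩ : ∃ m, d = m + 1 + 1 := ⟨d - 2, by omega⟩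
  rw [pairingMod_sum_degreeEq, sum_stdEdge_unif_add_div]
  simp [natCast_card_eq_zero Fq p]

/-- In degree `1` the smaller power is `q^0 = 1`, so a term survives modulo `p`; by
`stdEdge_two_zero` it is opposite to the contribution of the unit ideal. -/
theorem sum_degreeEq_zero_add_one_mem_leftKernelMod :
    (∑ 𝔭 ∈ idealsDegreeEq Fq 0, heckeEltMod p 𝔫 𝔭) +
      (∑ 𝔭 ∈ idealsDegreeEq Fq 1, heckeEltMod p 𝔫 𝔭) ∈ leftKernelMod 𝔫 hη₀ := by
  refine LinearMap.mem_ker.2 (LinearMap.ext fun G => ?_)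
  obtain ⟨F, rfl⟩ := reduceMod_surjective p 𝔫 G
  rw [map_add, LinearMap.add_apply, pairingMod_sum_degreeEq, pairingMod_sum_degreeEq,
    sum_stdEdge_unif_add_div F 0, zero_add, Nat.cast_one, one_add_one_eq_two, stdEdge_two_zero]
  simp [natCast_card_eq_zero Fq p, tuplePoly, monicTuplePoly]

theorem sum_degreeLE_mem_leftKernelMod {d : ℕ} (hd : 1 ≤ d) :
    (∑ 𝔭 ∈ idealsDegreeLE Fq d, heckeEltMod p 𝔫 𝔭) ∈ leftKernelMod 𝔫 hη₀ := by
  obtain ⟨m, rfl⟩ : ∃ m, d = m + 1 := ⟨d - 1, by omega⟩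
  -- Degrees `0` and `1` are split off and paired; each remaining degree is at least `2` and lies in
  -- the kernel by itself.
  rw [sum_idealsDegreeLE, Finset.sum_range_succ', Finset.sum_range_succ', zero_add, add_assoc,
    add_comm (∑ 𝔭 ∈ idealsDegreeEq Fq 1, _)]
  exact Submodule.add_mem _
    (Submodule.sum_mem _ fun i _ => sum_degreeEq_mem_leftKernelMod hη₀ (by omega))
    (sum_degreeEq_zero_add_one_mem_leftKernelMod hη₀)

end LeftKernel

end FunctionFieldHarmonic

theorem mainTheorem4 (p : ℕ) [Fact p.Prime] (Fq : Type*) [Field Fq] [Fintype Fq]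
    [Algebra (ZMod p) Fq] (η₀ : AddChar (ZMod p) ℂ) (hη₀ : η₀ ≠ 1)
    (𝔫 : Ideal Fq[X]) [NeZero 𝔫] :
    (∀ d : ℕ, 1 ≤ d →
      (∑ 𝔭 ∈ idealsDegreeLE Fq d, heckeEltMod p 𝔫 𝔭) ∈ leftKernelMod 𝔫 hη₀) ∧
    (∀ d : ℕ, 2 ≤ d →
      (∑ 𝔭 ∈ idealsDegreeEq Fq d, heckeEltMod p 𝔫 𝔭) ∈ leftKernelMod 𝔫 hη₀) :=
  ⟨fun _ hd => sum_degreeLE_mem_leftKernelMod hη₀ hd,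
    fun _ hd => sum_degreeEq_mem_leftKernelMod hη₀ hd⟩
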